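/- Let $d\ge 1$ and let $U:\mathbb R^d\to\mathbb R$ be continuously differentiable with global minimum at $0$. Assume that there are $L\ge 0$ and $m\ge 0$ such that, for all $x,y\in\mathbb R^d$, $$\|\nabla U(x)-\nabla U(y)\|\le L\|x-y\|,\qquad U(y)\ge U(x)+\langle\nabla U(x),y-x\rangle+\tfrac m2\|x-y\|^2 .$$ Let $M\ge 1$ and let $(\sigma_j^2)_{0\le j\le M}$ be a nondecreasing sequence in $(0,+\infty]$ with $\sigma_j^2<+\infty$ for $j<M$ and $\sigma_M^2=+\infty$ (convention $1/\infty=0$). Fix $i\in\{0,\dots,M-1\}$ and put $$U_i(x)=\frac{\|x\|^2}{2\sigma_i^2}+U(x),\quad a_i=\frac12\Big(\frac1{\sigma_i^2}-\frac1{\sigma_{i+1}^2}\Big),\quad g_i(x)=e^{a_i\|x\|^2},$$ $$L_i=L+\frac1{\sigma_i^2},\quad m_i=m+\frac1{\sigma_i^2},\quad \kappa_i=\frac{2m_iL_i}{m_i+L_i}.$$ Assume that the step size $\gamma_i$ and the variance $\sigma_{i+1}^2$ satisfy $$0<\gamma_i\le\frac1{m+L+2/\sigma_i^2},\qquad \sigma_{i+1}^2\le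 2(d+4)\Big(\frac{2d+7}{\sigma_i^2}-m\Big)_+^{-1}\qquad(\text{with }1/0=+\infty),$$ and put $$C_{i,0}=\exp\Big(\frac{4a_i(d+2)}{\kappa_i-8a_i}\Big),\qquad C_{i,1}=2d\,\frac{1-8a_i\gamma_i}{\kappa_i-8a_i}.$$ Let $(W_{i,k})_{k\ge1}$ be i.i.d. standard Gaussian vectors in $\mathbb R^d$, let $X_{i,0}=0$ and $$X_{i,k+1}=X_{i,k}-\gamma_i\nabla U_i(X_{i,k})+\sqrt{2\gamma_i}\,W_{i,k+1}\qquad(k\ge0),$$ and, for integers $N_i\ge 0$ and $n_i\ge1$, let $$\hat\pi_i(g_i)=\frac1{n_i}\sum_{k=N_i+1}^{N_i+n_i}g_i(X_{i,k}).$$ Then $\hat\pi_i(g_i)$ is square integrable and $$\operatorname{Var}\{\hat\pi_i(g_i)\}\le\frac{32\,a_i^2\,C_{i,0}\,C_{i,1}}{\kappa_i^2\,n_i\,\gamma_i}\Big(1+\frac{2}{\kappa_i\,n_i\,\gamma_i}\Big).$$ -/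

import Mathlib

open MeasureTheory ProbabilityTheory
open scoped ENNReal

noncomputable section

namespace AnnealedULA

/-- `U` is continuously differentiable with `L`-Lipschitz gradient. -/
def GradientLipschitz {d : ℕ} (L : ℝ) (U : EuclideanSpace ℝ (Fin d) → ℝ) : Prop :=
  ContDiff ℝ 1 U ∧ 0 ≤ L ∧ ∀ x y, ‖gradient U x - gradient U y‖ ≤ L * ‖x - y‖

/-- `U` is continuously differentiable and `m`-strongly convex (convex if `m = 0`). -/
def GradientConvex {d : ℕ} (m : ℝ) (U : EuclideanSpace ℝ (Fin d) → ℝ) : Prop :=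
  ContDiff ℝ 1 U ∧
    ∀ x y, U x + inner ℝ (gradient U x) (y - x) + m / 2 * ‖x - y‖ ^ 2 ≤ U y

/-- `1 / σ²` for a variance `s = σ² ∈ (0, +∞]`, with `1 / (+∞) = 0`. -/
def precision (s : ℝ≥0∞) : ℝ := (s⁻¹).toReal

/-- The annealed potential `U_i(x) = ‖x‖² / (2 σ_i²) + U(x)`, where `s = σ_i²`. -/
def potential {d : ℕ} (U : EuclideanSpace ℝ (Fin d) → ℝ) (s : ℝ≥0∞)
    (x : EuclideanSpace ℝ (Fin d)) : ℝ :=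
  precision s * ‖x‖ ^ 2 / 2 + U x

/-- `a_i = (1 / σ_i² - 1 / σ_{i+1}²) / 2`, where `s = σ_i²` and `s' = σ_{i+1}²`. -/
def tilt (s s' : ℝ≥0∞) : ℝ := (precision s - precision s') / 2

/-- `g_i(x) = exp (a_i ‖x‖²)`. -/
def tiltFun {d : ℕ} (a : ℝ) (x : EuclideanSpace ℝ (Fin d)) : ℝ := Real.exp (a * ‖x‖ ^ 2)

/-- `L_i = L + 1 / σ_i²`. -/
def lipConst (L : ℝ) (s : ℝ≥0∞) : ℝ := L + precision s

/-- `m_i = m + 1 / σ_i²`. -/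
def convConst (m : ℝ) (s : ℝ≥0∞) : ℝ := m + precision s

/-- `κ_i = 2 m_i L_i / (m_i + L_i)`. -/
def kappa (m L : ℝ) (s : ℝ≥0∞) : ℝ :=
  2 * convConst m s * lipConst L s / (convConst m s + lipConst L s)

/-- `C_{i,0} = exp (4 a_i (d + 2) / (κ_i - 8 a_i))`. -/
def constC0 (d : ℕ) (κ a : ℝ) : ℝ := Real.exp (4 * a * (d + 2) / (κ - 8 * a))

/-- `C_{i,1} = 2 d (1 - 8 a_i γ_i) / (κ_i - 8 a_i)`. -/
def constC1 (d : ℕ) (κ a γ : ℝ) : ℝ := 2 * d * ((1 - 8 * a * γ) / (κ - 8 * a))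

/-- The unadjusted Langevin chain for the potential `V` with step size `γ`, started at `0`:
`X_{k+1} = X_k - γ ∇V(X_k) + √(2γ) W_{k+1}`. The noise `W_{k+1}` used in the step
from `X_k` to `X_{k+1}` is the entry of index `k` of the sequence `W`. -/
def ulaChain {d : ℕ} {Ω : Type*} (V : EuclideanSpace ℝ (Fin d) → ℝ) (γ : ℝ)
    (W : ℕ → Ω → EuclideanSpace ℝ (Fin d)) : ℕ → Ω → EuclideanSpace ℝ (Fin d)
  | 0, _ => 0
  | k + 1, ω =>
      ulaChain V γ W k ω - γ • gradient V (ulaChain V γ W k ω) + Real.sqrt (2 * γ) • W k ω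

/-- The estimator `(1 / n) ∑_{k = N + 1}^{N + n} g(X_k)`. -/
def ulaEstimator {d : ℕ} {Ω : Type*} (X : ℕ → Ω → EuclideanSpace ℝ (Fin d))
    (g : EuclideanSpace ℝ (Fin d) → ℝ) (N n : ℕ) (ω : Ω) : ℝ :=
  (1 / (n : ℝ)) * ∑ k ∈ Finset.Icc (N + 1) (N + n), g (X k ω)

/-- The condition `σ_{i+1}² ≤ 2 (d + 4) ((2 d + 7) / σ_i² - m)₊⁻¹` in `[0, +∞]`,
with `1 / 0 = +∞`; here `s = σ_i²` and `s' = σ_{i+1}²`. -/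
def VarianceCondition (d : ℕ) (m : ℝ) (s s' : ℝ≥0∞) : Prop :=
  s' ≤ 2 * ((d : ℝ≥0∞) + 4) * (ENNReal.ofReal ((2 * d + 7) * precision s - m))⁻¹

/-- The condition `γ_i ∈ (0, 1 / (m + L + 2 / σ_i²)]`, where `s = σ_i²`. -/
def StepCondition (m L : ℝ) (s : ℝ≥0∞) (γ : ℝ) : Prop :=
  0 < γ ∧ γ ≤ 1 / (m + L + 2 * precision s)

end AnnealedULA

end

/-! Write the estimator as S = ∑ w_k g(X_k) and let R be the Markov operator of the chain. The
conditional expectation of the part of S from time k on is V_k(X_k), where V_k = ∑_j w_{k+j} R^j g.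
The variance of S is then the sum of the second moments of the orthogonal martingale increments
V_{k+1}(X_{k+1}) - R V_{k+1}(X_k) (`IsLangevinStep.variance_sum_le`). Given X_k, an increment is a
centred function of a Gaussian vector scaled by √(2γ), so the Gaussian Poincaré inequality bounds
its conditional variance by 2γ times R of the squared slope of V_{k+1}.

Cocoercivity of the gradient makes the drift contract distances by ρ = √(1 - κγ). Two copies driven
by the same noise show that R^j g has slope at most ρ^j R^j q, where q = |∇g|. By Cauchy-Schwarz and
Jensen, it remains to bound E q(X_k)² = 4a² E |X_k|² exp(2a|X_k|²) uniformly in k and to sum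
geometric series, with 1 - ρ ≥ κγ/2. For the moment, R sends (α + β|x|²) exp(c|x|²) below a function
of the same form with a smaller c; the prefactors telescope into C_0, and C_1 is the fixed point of
the recursion for the quadratic part (`IsLangevinStep.moment_le`). The variance condition serves to
give 20a ≤ κ, which keeps all these moments finite.

Poincaré comes from Efron-Stein. With φ(t) = E f(X)f(X') at correlation t, splitting the independent
part of the noise in two gives 2φ((1+t)/2) ≤ φ(1) + φ(t). Iterating from t = 0 yields Var f ≤ 2^k
(φ(1) - φ(1 - 2^{-k})), and the right side tends to E|∇f|². Slopes are recorded by `HasSlopeBound`,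
which is linear in the bound and involves only end points: it passes through R without
differentiation under the integral, and Rademacher's theorem recovers the gradient almost
everywhere. -/

namespace AnnealedULA

/-! ### Standard Gaussian measure: density, exponential moments, rotations -/

section Gaussian

open Module

variable {E : Type*} [NormedAddCommGroup E] [InnerProductSpace ℝ E]

/-- The density of the standard Gaussian measure. -/
noncomputable def gaussianDensity (x : E) : ℝ :=
  (2 * Real.pi) ^ (-(finrank ℝ E / 2 : ℝ)) * Real.exp (-(1 / 2) * ‖x‖ ^ 2)

theorem gaussianDensity_nonneg (x : E) : 0 ≤ gaussianDensity x := by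
  unfold gaussianDensity; positivity

theorem continuous_gaussianDensity : Continuous (gaussianDensity : E → ℝ) := by
  unfold gaussianDensity; fun_prop

theorem gaussianDensity_mul_exp (c s : ℝ) (b v : E) :
    gaussianDensity v * Real.exp (c * ‖b + s • v‖ ^ 2)
      = ((2 * Real.pi) ^ (-(finrank ℝ E / 2 : ℝ)) * Real.exp (c * ‖b‖ ^ 2)) *
        Real.exp (-(1 / 2 - c * s ^ 2) * ‖v‖ ^ 2 + inner ℝ ((2 * c * s) • b) v) := by
  have : ‖b + s • v‖ ^ 2 = ‖b‖ ^ 2 + 2 * s * inner ℝ b v + s ^ 2 * ‖v‖ ^ 2 := by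
    rw [norm_add_sq_real, norm_smul, inner_smul_right, mul_pow, Real.norm_eq_abs, sq_abs]
    ring
  rw [gaussianDensity, mul_assoc, mul_assoc, ← Real.exp_add, ← Real.exp_add, this,
    real_inner_smul_left]
  ring_nf

variable [FiniteDimensional ℝ E] [MeasurableSpace E] [BorelSpace E]

theorem integrable_rexp_neg_mul_sq_norm_add {b : ℝ} (hb : 0 < b) (w : E) :
    Integrable (fun v : E => Real.exp (-b * ‖v‖ ^ 2 + inner ℝ w v)) := by
  have h := (GaussianFourier.integrable_cexp_neg_mul_sq_norm_add
    (show 0 < (b : ℂ).re from hb) 1 w).re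
  refine h.congr (.of_forall fun v => ?_)
  have : (-(b : ℂ) * (‖v‖ : ℂ) ^ 2 + 1 * ((inner ℝ w v : ℝ) : ℂ))
      = ((-b * ‖v‖ ^ 2 + inner ℝ w v : ℝ) : ℂ) := by push_cast; ring
  simp only [this, ← Complex.ofReal_exp]
  exact Complex.ofReal_re _

theorem integral_rexp_neg_mul_sq_norm_add {b : ℝ} (hb : 0 < b) (w : E) :
    ∫ v : E, Real.exp (-b * ‖v‖ ^ 2 + inner ℝ w v)
      = (Real.pi / b) ^ (finrank ℝ E / 2 : ℝ) * Real.exp (‖w‖ ^ 2 / (4 * b)) := by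
  have h := GaussianFourier.integral_cexp_neg_mul_sq_norm_add
    (show 0 < (b : ℂ).re from hb) 1 w
  have h1 : ∀ v : E, Complex.exp (-(b : ℂ) * (‖v‖ : ℂ) ^ 2 + 1 * ((inner ℝ w v : ℝ) : ℂ))
      = ((Real.exp (-b * ‖v‖ ^ 2 + inner ℝ w v) : ℝ) : ℂ) := fun v => by
    rw [Complex.ofReal_exp]; push_cast; ring_nf
  simp_rw [h1] at h
  rw [integral_complex_ofReal] at h
  rw [← Complex.ofReal_inj, h]
  have hp : (0 : ℝ) ≤ Real.pi / b := by positivity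
  push_cast
  rw [Complex.ofReal_cpow hp]
  push_cast
  ring_nf

/-- Both measures have characteristic function exp(-‖t‖²/2). -/
theorem stdGaussian_eq_withDensity :
    stdGaussian E = volume.withDensity fun x => ENNReal.ofReal (gaussianDensity x) := by
  have hi : Integrable (gaussianDensity : E → ℝ) := by
    have := (integrable_rexp_neg_mul_sq_norm_add (E := E) (b := 1 / 2) (by norm_num) 0).const_mul
      ((2 * Real.pi) ^ (-(finrank ℝ E / 2 : ℝ)))
    exact this.congr (.of_forall fun v => by simp [gaussianDensity])
  have : IsFiniteMeasure (volume.withDensity fun x : E => ENNReal.ofReal (gaussianDensity x)) :=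
    isFiniteMeasure_withDensity_ofReal hi.2
  apply Measure.ext_of_charFun
  ext t
  rw [charFun_stdGaussian, charFun_apply, integral_withDensity_eq_integral_toReal_smul
    (by exact continuous_gaussianDensity.measurable.ennreal_ofReal) (by simp)]
  have h := GaussianFourier.integral_cexp_neg_mul_sq_norm_add (V := E)
    (show 0 < ((1 / 2 : ℝ) : ℂ).re by norm_num) Complex.I t
  have h1 : ∀ v : E, (ENNReal.ofReal (gaussianDensity v)).toReal •
      Complex.exp ((inner ℝ v t : ℝ) * Complex.I)
      = ((2 * Real.pi) ^ (-(finrank ℝ E / 2 : ℝ)) : ℝ) * Complex.exp (-((1 / 2 : ℝ) : ℂ) * (‖v‖ : ℂ) ^ 2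
        + Complex.I * ((inner ℝ t v : ℝ) : ℂ)) := fun v => by
    rw [ENNReal.toReal_ofReal (gaussianDensity_nonneg v), gaussianDensity, Complex.real_smul,
      Complex.ofReal_mul, Complex.ofReal_exp, mul_assoc, ← Complex.exp_add, real_inner_comm]
    push_cast
    ring_nf
  simp_rw [h1]
  rw [integral_const_mul, h, ← mul_assoc]
  have h2 : (((2 * Real.pi) ^ (-(finrank ℝ E / 2 : ℝ)) : ℝ) : ℂ) *
      ((Real.pi : ℂ) / ((1 / 2 : ℝ) : ℂ)) ^ (finrank ℝ E / 2 : ℂ) = 1 := by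
    have e1 : (Real.pi : ℂ) / ((1 / 2 : ℝ) : ℂ) = ((2 * Real.pi : ℝ) : ℂ) := by
      push_cast; ring
    have e2 : (finrank ℝ E / 2 : ℂ) = ((finrank ℝ E / 2 : ℝ) : ℂ) := by push_cast; rfl
    rw [e1, e2, ← Complex.ofReal_cpow (by positivity), ← Complex.ofReal_mul,
      Real.rpow_neg (by positivity), inv_mul_cancel₀ (by positivity)]
    simp
  rw [h2, one_mul]
  congr 1
  rw [Complex.I_sq]
  push_cast
  ring

theorem stdGaussian_absolutelyContinuous : stdGaussian E ≪ volume := by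
  rw [stdGaussian_eq_withDensity]
  exact withDensity_absolutelyContinuous _ _

theorem integrable_exp_sq_norm_stdGaussian {c s : ℝ} (h : 2 * c * s ^ 2 < 1) (b : E) :
    Integrable (fun w => Real.exp (c * ‖b + s • w‖ ^ 2)) (stdGaussian E) := by
  rw [stdGaussian_eq_withDensity, integrable_withDensity_iff_integrable_smul'
    (by exact continuous_gaussianDensity.measurable.ennreal_ofReal) (by simp)]
  simp_rw [ENNReal.toReal_ofReal (gaussianDensity_nonneg _), smul_eq_mul, gaussianDensity_mul_exp]
  exact (integrable_rexp_neg_mul_sq_norm_add (by linarith) _).const_mul _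

/-- Completing the square: the combined exponent is quadratic with precision 1 - 2cs² and linear
term 2cs b. -/
theorem integral_exp_sq_norm_stdGaussian {c s : ℝ} (h : 2 * c * s ^ 2 < 1) (b : E) :
    ∫ w, Real.exp (c * ‖b + s • w‖ ^ 2) ∂(stdGaussian E)
      = (1 - 2 * c * s ^ 2) ^ (-(finrank ℝ E / 2 : ℝ))
        * Real.exp (c * ‖b‖ ^ 2 / (1 - 2 * c * s ^ 2)) := by
  rw [stdGaussian_eq_withDensity, integral_withDensity_eq_integral_toReal_smul
    (by exact continuous_gaussianDensity.measurable.ennreal_ofReal) (by simp)]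
  simp_rw [ENNReal.toReal_ofReal (gaussianDensity_nonneg _), smul_eq_mul, gaussianDensity_mul_exp]
  have hD : 0 < 1 - 2 * c * s ^ 2 := by linarith
  rw [integral_const_mul, integral_rexp_neg_mul_sq_norm_add (by linarith)]
  have e1 : Real.pi / (1 / 2 - c * s ^ 2) = (2 * Real.pi) * (1 - 2 * c * s ^ 2)⁻¹ := by
    field_simp
  have e2 : (2 * Real.pi) ^ (-(finrank ℝ E / 2 : ℝ)) * (2 * Real.pi) ^ (finrank ℝ E / 2 : ℝ) = 1 := by
    rw [Real.rpow_neg (by positivity), inv_mul_cancel₀ (by positivity)]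
  have e3 : Real.exp (c * ‖b‖ ^ 2 / (1 - 2 * c * s ^ 2)) = Real.exp (c * ‖b‖ ^ 2) *
      Real.exp (‖(2 * c * s) • b‖ ^ 2 / (4 * (1 / 2 - c * s ^ 2))) := by
    rw [← Real.exp_add, norm_smul, mul_pow, Real.norm_eq_abs, sq_abs]
    congr 1
    obtain ⟨D, hDdef⟩ : ∃ D, D = 1 - 2 * c * s ^ 2 := ⟨_, rfl⟩
    have h1 : 1 / 2 - c * s ^ 2 = D / 2 := by rw [hDdef]; ring
    have h2 : (2 * c * s) ^ 2 = 2 * c * (1 - D) := by rw [hDdef]; ring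
    rw [← hDdef] at hD ⊢
    rw [h1, h2]
    field_simp
    ring
  rw [e1, Real.mul_rpow (x := 2 * Real.pi) (by positivity) (by positivity), e3, Real.inv_rpow hD.le,
    ← Real.rpow_neg hD.le]
  calc _ = ((2 * Real.pi) ^ (-(finrank ℝ E / 2 : ℝ)) * (2 * Real.pi) ^ (finrank ℝ E / 2 : ℝ)) *
        ((1 - 2 * c * s ^ 2) ^ (-(finrank ℝ E / 2 : ℝ)) * (Real.exp (c * ‖b‖ ^ 2) *
      Real.exp (‖(2 * c * s) • b‖ ^ 2 / (4 * (1 / 2 - c * s ^ 2))))) := by ring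
    _ = _ := by rw [e2, one_mul]

/-- The product of two standard Gaussian measures is invariant under rotations. -/
theorem map_rotation_stdGaussian {α β : ℝ} (h : α ^ 2 + β ^ 2 = 1) :
    ((stdGaussian E).prod (stdGaussian E)).map
      (fun p : E × E => (α • p.1 + β • p.2, -β • p.1 + α • p.2))
      = (stdGaussian E).prod (stdGaussian E) := by
  -- The angle is the argument of the unit complex number α + iβ.
  obtain ⟨θ, hc, hs⟩ : ∃ θ : ℝ, Real.cos θ = α ∧ Real.sin θ = β := by
    have hn : ‖(⟨α, β⟩ : ℂ)‖ = 1 := by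
      rw [← sq_eq_sq₀ (norm_nonneg _) zero_le_one, Complex.sq_norm, Complex.normSq_mk]
      linarith [h]
    have h0 : (⟨α, β⟩ : ℂ) ≠ 0 := by
      intro h; rw [h] at hn; simp at hn
    exact ⟨Complex.arg ⟨α, β⟩, by rw [Complex.cos_arg h0, hn]; simp,
      by rw [Complex.sin_arg, hn]; simp⟩
  subst hc hs
  exact IsGaussian.map_rotation_eq_self (by simp) θ

end Gaussian


/-! ### Efron-Stein inequality in two variables -/

section EfronStein

theorem integrable_of_abs_le {α : Type*} [MeasurableSpace α] {ν : Measure α} [IsFiniteMeasure ν]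
    {f : α → ℝ} (hf : Measurable f) {C : ℝ} (hC : ∀ x, |f x| ≤ C) : Integrable f ν :=
  Integrable.of_bound hf.aestronglyMeasurable C (.of_forall hC)

theorem abs_integral_le_of_abs_le {α : Type*} [MeasurableSpace α] {ν : Measure α}
    [IsProbabilityMeasure ν] {f : α → ℝ} {C : ℝ} (hC : ∀ x, |f x| ≤ C) : |∫ x, f x ∂ν| ≤ C := by
  have := norm_integral_le_of_norm_le_const (μ := ν) (f := f) (C := C) (.of_forall hC)
  simpa using this

theorem abs_sq_le {x C : ℝ} (h : |x| ≤ C) : |x ^ 2| ≤ C ^ 2 := by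
  rw [abs_pow]; gcongr

/-- The Efron–Stein inequality for a bounded function of two independent variables. -/
theorem efronStein_two {α β : Type*} [MeasurableSpace α] [MeasurableSpace β] (ν : Measure α)
    (ρ : Measure β) [IsProbabilityMeasure ν] [IsProbabilityMeasure ρ] {F : α → β → ℝ}
    (hF : Measurable fun p : α × β => F p.1 p.2) {C : ℝ} (hC : ∀ a b, |F a b| ≤ C) :
    ∫ b, (∫ a, F a b ∂ν) ^ 2 ∂ρ + ∫ a, (∫ b, F a b ∂ρ) ^ 2 ∂ν
      ≤ ∫ a, ∫ b, F a b ^ 2 ∂ρ ∂ν + (∫ a, ∫ b, F a b ∂ρ ∂ν) ^ 2 := by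
  set v : α → ℝ := fun a => ∫ b, F a b ∂ρ with hv
  set u : β → ℝ := fun b => ∫ a, F a b ∂ν with hu
  set w : ℝ := ∫ a, v a ∂ν with hw
  have hvm : Measurable v := (hF.stronglyMeasurable.integral_prod_right).measurable
  have hum : Measurable u := (hF.stronglyMeasurable.integral_prod_left).measurable
  have hvC : ∀ a, |v a| ≤ C := fun a => abs_integral_le_of_abs_le (hC a)
  have huC : ∀ b, |u b| ≤ C := fun b => abs_integral_le_of_abs_le (fun a => hC a b)
  have hFa : ∀ a, Measurable (F a) := fun a => hF.comp measurable_prodMk_left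
  have hwu : w = ∫ b, u b ∂ρ := by
    rw [hw, hv, hu]
    exact integral_integral_swap (integrable_of_abs_le hF fun p => hC p.1 p.2)
  -- The inequality is the nonnegativity of the squared L² norm of F - u - v + w, the interaction
  -- term left after removing the marginal means; here the square is expanded for fixed a.
  have hinner : ∀ a, ∫ b, (F a b - u b - v a + w) ^ 2 ∂ρ
      = ∫ b, F a b ^ 2 ∂ρ + ∫ b, u b ^ 2 ∂ρ - 2 * ∫ b, F a b * u b ∂ρ
        - v a ^ 2 + 2 * v a * w - w ^ 2 := by
    intro a
    have i1 : Integrable (fun b => F a b ^ 2) ρ :=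
      integrable_of_abs_le ((hFa a).pow_const 2) fun b => abs_sq_le (hC a b)
    have i2 : Integrable (fun b => u b ^ 2) ρ :=
      integrable_of_abs_le (hum.pow_const 2) fun b => abs_sq_le (huC b)
    have i3 : Integrable (fun b => F a b * u b) ρ :=
      integrable_of_abs_le (C := C * C) ((hFa a).mul hum) fun b => by
        rw [abs_mul]
        exact mul_le_mul (hC a b) (huC b) (abs_nonneg _) ((abs_nonneg _).trans (hC a b))
    have i4 : Integrable (F a) ρ := integrable_of_abs_le (hFa a) (hC a)
    have i5 : Integrable u ρ := integrable_of_abs_le hum huC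
    have e : ∀ b, (F a b - u b - v a + w) ^ 2 = F a b ^ 2 + u b ^ 2 - 2 * (F a b * u b)
        + (2 * (w - v a)) * F a b - (2 * (w - v a)) * u b + (w - v a) ^ 2 := fun b => by ring
    simp_rw [e]
    rw [integral_add (by fun_prop) (by fun_prop), integral_sub (by fun_prop) (by fun_prop),
      integral_add (by fun_prop) (by fun_prop), integral_sub (by fun_prop) (by fun_prop),
      integral_add i1 i2, integral_const_mul, integral_const_mul, integral_const_mul, ← hwu]
    simp only [integral_const, probReal_univ, one_smul]
    have : ∫ b, F a b ∂ρ = v a := rfl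
    rw [this]
    ring
  have h0 : 0 ≤ ∫ a, ∫ b, (F a b - u b - v a + w) ^ 2 ∂ρ ∂ν :=
    integral_nonneg fun a => integral_nonneg fun b => sq_nonneg _
  have hFu : ∫ a, ∫ b, F a b * u b ∂ρ ∂ν = ∫ b, u b ^ 2 ∂ρ := by
    rw [integral_integral_swap]
    · refine integral_congr_ae (.of_forall fun b => ?_)
      simp only [integral_mul_const]
      rw [sq]
    · refine integrable_of_abs_le (C := C * C) (hF.mul (hum.comp measurable_snd)) fun p => ?_
      simp only [Function.uncurry, abs_mul]
      exact mul_le_mul (hC _ _) (huC _) (abs_nonneg _) ((abs_nonneg _).trans (hC p.1 p.2))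
  simp_rw [hinner] at h0
  have j1 : Integrable (fun a => ∫ b, F a b ^ 2 ∂ρ) ν :=
    integrable_of_abs_le ((hF.pow_const 2).stronglyMeasurable.integral_prod_right).measurable
      fun a => abs_integral_le_of_abs_le fun b => abs_sq_le (hC a b)
  have j2 : Integrable (fun a => ∫ b, F a b * u b ∂ρ) ν :=
    integrable_of_abs_le (C := C * C)
      ((hF.mul (hum.comp measurable_snd)).stronglyMeasurable.integral_prod_right).measurable
      fun a => abs_integral_le_of_abs_le fun b => by
        rw [abs_mul]
        exact mul_le_mul (hC a b) (huC b) (abs_nonneg _) ((abs_nonneg _).trans (hC a b))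
  have j3 : Integrable v ν := integrable_of_abs_le hvm hvC
  have j4 : Integrable (fun a => v a ^ 2) ν :=
    integrable_of_abs_le (hvm.pow_const 2) fun a => abs_sq_le (hvC a)
  have j5 : Integrable (fun a => 2 * v a * w) ν := (j3.const_mul 2).mul_const w
  rw [integral_sub (by fun_prop) (by fun_prop), integral_add (by fun_prop) (by fun_prop),
    integral_sub (by fun_prop) (by fun_prop), integral_sub (by fun_prop) (by fun_prop),
    integral_add j1 (by fun_prop), integral_const_mul, hFu, integral_mul_const,
    integral_const_mul] at h0
  simp only [integral_const, probReal_univ, one_smul] at h0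
  rw [← hw] at h0
  linarith [h0]

theorem integral_integral_sub_sq {α : Type*} [MeasurableSpace α] {ν : Measure α}
    [IsProbabilityMeasure ν] {f : α → ℝ} (i1 : Integrable f ν)
    (i2 : Integrable (fun x => f x ^ 2) ν) :
    ∫ x, ∫ y, (f x - f y) ^ 2 ∂ν ∂ν = 2 * ∫ x, f x ^ 2 ∂ν - 2 * (∫ x, f x ∂ν) ^ 2 := by
  have e : ∀ x y, (f x - f y) ^ 2 = f x ^ 2 - 2 * f x * f y + f y ^ 2 := fun x y => by ring
  have e' : ∀ x, ∫ y, (f x - f y) ^ 2 ∂ν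
      = f x ^ 2 - 2 * f x * ∫ y, f y ∂ν + ∫ y, f y ^ 2 ∂ν := by
    intro x
    simp_rw [e]
    rw [integral_add (by fun_prop) i2, integral_sub (by fun_prop) (by fun_prop),
      integral_const_mul]
    simp
  simp_rw [e']
  rw [integral_add (by fun_prop) (by fun_prop), integral_sub i2 (by fun_prop),
    integral_mul_const, integral_const_mul]
  simp only [integral_const, probReal_univ, one_smul]
  ring

end EfronStein

/-! ### Gaussian correlation function and its midpoint inequality -/

section Stability

variable {E : Type*} [NormedAddCommGroup E] [InnerProductSpace ℝ E] [FiniteDimensional ℝ E]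
  [MeasurableSpace E] [BorelSpace E]

theorem integral_prod_rotation_stdGaussian {α β : ℝ} (h : α ^ 2 + β ^ 2 = 1) {f : E × E → ℝ}
    (hf : Measurable f) :
    ∫ p, f (α • p.1 + β • p.2, -β • p.1 + α • p.2) ∂((stdGaussian E).prod (stdGaussian E))
      = ∫ p, f p ∂((stdGaussian E).prod (stdGaussian E)) := by
  conv_rhs => rw [← map_rotation_stdGaussian h]
  rw [integral_map (by fun_prop) hf.aestronglyMeasurable]

/-- Stability: a combination of two independent Gaussian vectors is Gaussian. -/
theorem integral_integral_add_stdGaussian {α β δ : ℝ} (h : α ^ 2 + β ^ 2 = δ ^ 2)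
    {f : E → ℝ} (hf : Measurable f) {C : ℝ} (hC : ∀ x, |f x| ≤ C) :
    ∫ x, ∫ y, f (α • x + β • y) ∂(stdGaussian E) ∂(stdGaussian E)
      = ∫ z, f (δ • z) ∂(stdGaussian E) := by
  rcases eq_or_ne δ 0 with rfl | hδ
  · have h1 : α = 0 := by nlinarith [sq_nonneg α, sq_nonneg β]
    have h2 : β = 0 := by nlinarith [sq_nonneg α, sq_nonneg β]
    simp [h1, h2]
  have h' : (α / δ) ^ 2 + (β / δ) ^ 2 = 1 := by
    rw [div_pow, div_pow, ← add_div, h, div_self (by positivity)]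
  have := integral_prod_rotation_stdGaussian (E := E) h' (f := fun p => f (δ • p.1)) (by fun_prop)
  simp only [smul_add, smul_smul, mul_div_cancel₀ _ hδ] at this
  rw [integral_prod _ (integrable_of_abs_le (by fun_prop) fun p => hC _),
    integral_prod _ (integrable_of_abs_le (by fun_prop) fun p => hC _)] at this
  simpa using this

/-- `E[f(X) f(X')]` for standard Gaussian vectors `X`, `X'` with correlation `m`. -/
noncomputable def gaussianCorr (f : E → ℝ) (m : ℝ) : ℝ :=
  ∫ x, (∫ y, f (√m • x + √(1 - m) • y) ∂(stdGaussian E)) ^ 2 ∂(stdGaussian E)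

/-- Given the common part αA, the remaining noise of variance 1 - t is split into two independent
halves βb + βc. Efron-Stein in (b, c) has two equal terms on its left by symmetry, and freezing one
half raises the correlation from t to (1 + t)/2. -/
theorem two_mul_gaussianCorr_midpoint_le {f : E → ℝ} (hf : Measurable f) {C : ℝ}
    (hC : ∀ x, |f x| ≤ C) {t : ℝ} (h0 : 0 ≤ t) (h1 : t ≤ 1) :
    2 * gaussianCorr f ((1 + t) / 2)
      ≤ ∫ x, f x ^ 2 ∂(stdGaussian E) + gaussianCorr f t := by
  set μ := stdGaussian E with hμ
  set α := √t with hα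
  set β := √((1 - t) / 2) with hβ
  have ha : α ^ 2 = t := Real.sq_sqrt h0
  have hb : β ^ 2 = (1 - t) / 2 := Real.sq_sqrt (by linarith)
  have hES : ∀ A : E, 2 * ∫ c, (∫ b, f ((α • A + β • c) + β • b) ∂μ) ^ 2 ∂μ
      ≤ ∫ y, f (α • A + √(1 - t) • y) ^ 2 ∂μ
        + (∫ y, f (α • A + √(1 - t) • y) ∂μ) ^ 2 := by
    intro A
    have h := efronStein_two μ μ (F := fun b c => f ((α • A + β • c) + β • b)) (C := C)
      (by fun_prop) (fun b c => hC _)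
    have e1 : ∫ a, (∫ b, f ((α • A + β • b) + β • a) ∂μ) ^ 2 ∂μ
        = ∫ c, (∫ b, f ((α • A + β • c) + β • b) ∂μ) ^ 2 ∂μ := by
      simp_rw [add_right_comm]
    have e2 : ∫ b, ∫ c, f ((α • A + β • c) + β • b) ^ 2 ∂μ ∂μ
        = ∫ y, f (α • A + √(1 - t) • y) ^ 2 ∂μ := by
      rw [← integral_integral_add_stdGaussian (α := β) (β := β) (δ := √(1 - t))
        (f := fun z => f (α • A + z) ^ 2) (C := C ^ 2) (by
          rw [hb, Real.sq_sqrt (by linarith)]; ring) (by fun_prop) (fun x => abs_sq_le (hC _))]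
      refine integral_congr_ae (.of_forall fun b => integral_congr_ae (.of_forall fun c => ?_))
      simp only [add_assoc, add_comm (β • b)]
    have e3 : ∫ b, ∫ c, f ((α • A + β • c) + β • b) ∂μ ∂μ
        = ∫ y, f (α • A + √(1 - t) • y) ∂μ := by
      rw [← integral_integral_add_stdGaussian (α := β) (β := β) (δ := √(1 - t))
        (f := fun z => f (α • A + z)) (C := C) (by
          rw [hb, Real.sq_sqrt (by linarith)]; ring) (by fun_prop) (fun x => hC _)]
      refine integral_congr_ae (.of_forall fun b => integral_congr_ae (.of_forall fun c => ?_))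
      simp only [add_assoc, add_comm (β • b)]
    rw [e1, e2, e3] at h
    linarith
  have hmeas : Measurable fun z : E => (∫ b, f (z + β • b) ∂μ) ^ 2 := by
    have : Measurable fun p : E × E => f (p.1 + β • p.2) := by fun_prop
    exact (this.stronglyMeasurable.integral_prod_right).measurable.pow_const 2
  have hbd : ∀ z : E, |(∫ b, f (z + β • b) ∂μ) ^ 2| ≤ C ^ 2 := fun z =>
    abs_sq_le (abs_integral_le_of_abs_le fun b => hC _)
  have hm2 : Measurable fun A : E => ∫ y, f (α • A + √(1 - t) • y) ^ 2 ∂μ := by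
    have : Measurable fun p : E × E => f (α • p.1 + √(1 - t) • p.2) ^ 2 := by fun_prop
    exact (this.stronglyMeasurable.integral_prod_right).measurable
  have hm3 : Measurable fun A : E => (∫ y, f (α • A + √(1 - t) • y) ∂μ) ^ 2 := by
    have : Measurable fun p : E × E => f (α • p.1 + √(1 - t) • p.2) := by fun_prop
    exact (this.stronglyMeasurable.integral_prod_right).measurable.pow_const 2
  have hm1 : Measurable fun A : E => ∫ c, (∫ b, f ((α • A + β • c) + β • b) ∂μ) ^ 2 ∂μ := by
    have : Measurable fun p : E × E => (∫ b, f ((α • p.1 + β • p.2) + β • b) ∂μ) ^ 2 :=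
      hmeas.comp (by fun_prop : Measurable fun p : E × E => α • p.1 + β • p.2)
    exact (this.stronglyMeasurable.integral_prod_right).measurable
  have i2 := integrable_of_abs_le (ν := μ) hm2 (C := C ^ 2) fun A =>
    abs_integral_le_of_abs_le fun y => abs_sq_le (hC _)
  have i3 := integrable_of_abs_le (ν := μ) hm3 (C := C ^ 2) fun A =>
    abs_sq_le (abs_integral_le_of_abs_le fun y => hC _)
  have i1 := integrable_of_abs_le (ν := μ) hm1 (C := C ^ 2) fun A =>
    abs_integral_le_of_abs_le fun y => hbd _
  have hint := integral_mono (i1.const_mul 2) (i2.add i3) hES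
  simp only [Pi.add_apply] at hint
  rw [integral_const_mul, integral_add i2 i3] at hint
  have k1 : ∫ A, ∫ c, (∫ b, f ((α • A + β • c) + β • b) ∂μ) ^ 2 ∂μ ∂μ
      = gaussianCorr f ((1 + t) / 2) := by
    rw [integral_integral_add_stdGaussian (δ := √((1 + t) / 2))
      (f := fun z => (∫ b, f (z + β • b) ∂μ) ^ 2) (by
        rw [ha, hb, Real.sq_sqrt (by linarith)]; ring) hmeas hbd, gaussianCorr,
        show 1 - (1 + t) / 2 = (1 - t) / 2 by ring]
  have k2 : ∫ A, ∫ y, f (α • A + √(1 - t) • y) ^ 2 ∂μ ∂μ = ∫ x, f x ^ 2 ∂μ := by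
    rw [integral_integral_add_stdGaussian (δ := 1)
      (f := fun z => f z ^ 2) (by
        rw [ha, Real.sq_sqrt (by linarith)]; ring) (by fun_prop) (fun x => abs_sq_le (hC _))]
    simp only [one_smul, hμ]
  rw [k1, k2] at hint
  exact hint

/-- The variance is φ(1) - φ(0). The midpoint inequality reads φ(1) - φ(t) ≤ 2(φ(1) - φ((1+t)/2)),
and each use halves the distance from t to 1. -/
theorem sub_sq_integral_le_gaussianCorr {f : E → ℝ} (hf : Measurable f) {C : ℝ}
    (hC : ∀ x, |f x| ≤ C) (k : ℕ) :
    ∫ x, f x ^ 2 ∂(stdGaussian E) - (∫ x, f x ∂(stdGaussian E)) ^ 2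
      ≤ 2 ^ k * (∫ x, f x ^ 2 ∂(stdGaussian E) - gaussianCorr f (1 - (1 / 2) ^ k)) := by
  induction k with
  | zero => simp [gaussianCorr]
  | succ k ih =>
    have hk : ((1 : ℝ) / 2) ^ k ≤ 1 := pow_le_one₀ (by norm_num) (by norm_num)
    have hk0 : (0 : ℝ) ≤ (1 / 2) ^ k := by positivity
    have h := two_mul_gaussianCorr_midpoint_le hf hC (t := 1 - (1 / 2) ^ k)
      (by linarith) (by linarith)
    have e : (1 + (1 - ((1 : ℝ) / 2) ^ k)) / 2 = 1 - (1 / 2) ^ (k + 1) := by ring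
    rw [e] at h
    refine ih.trans ?_
    rw [pow_succ, mul_assoc]
    refine mul_le_mul_of_nonneg_left ?_ (by positivity)
    linarith

/-- Half the mean squared difference of an exchangeable pair: both points share αD and have
independent parts of weight β. The first point is itself made a coordinate, so that the gradient can
be taken there. -/
theorem sub_gaussianCorr_eq {f : E → ℝ} (hf : Measurable f) {C : ℝ}
    (hC : ∀ x, |f x| ≤ C) {ε : ℝ} (h0 : 0 ≤ ε) (h1 : ε ≤ 1) :
    ∫ x, f x ^ 2 ∂(stdGaussian E) - gaussianCorr f (1 - ε)
      = 1 / 2 * ∫ p : (E × E) × E,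
        (f p.1.1 - f (√(1 - ε) • (√(1 - ε) • p.1.1 - √ε • p.1.2) + √ε • p.2)) ^ 2
        ∂(((stdGaussian E).prod (stdGaussian E)).prod (stdGaussian E)) := by
  set μ := stdGaussian E with hμ
  set α := √(1 - ε) with hα
  set β := √ε with hβ
  have ha : α ^ 2 = 1 - ε := Real.sq_sqrt (by linarith)
  have hb : β ^ 2 = ε := Real.sq_sqrt (by linarith)
  have hbd : ∀ x y : E, |(f x - f y) ^ 2| ≤ (C + C) ^ 2 := fun x y =>
    abs_sq_le ((abs_sub _ _).trans (add_le_add (hC _) (hC _)))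
  have hG : Measurable fun p : E × E =>
      ∫ b, (f (α • p.1 + β • p.2) - f (α • p.1 + β • b)) ^ 2 ∂μ := by
    have : Measurable fun p : (E × E) × E =>
      (f (α • p.1.1 + β • p.1.2) - f (α • p.1.1 + β • p.2)) ^ 2 := by fun_prop
    exact (this.stronglyMeasurable.integral_prod_right).measurable
  have hr := integral_prod_rotation_stdGaussian (E := E) (α := α) (β := -β)
    (by rw [ha, neg_sq, hb]; ring) hG
  rw [← hμ] at hr
  rw [integral_prod _ (integrable_of_abs_le (by fun_prop) fun p => hbd _ _)]
  -- The rotation D = αx - βz, B = βx + αz preserves the Gaussian law and gives x = αD + βB.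
  have e1 : ∀ p : E × E, ∫ b, (f p.1 - f (α • (α • p.1 - β • p.2) + β • b)) ^ 2 ∂μ
      = ∫ b, (f (α • (α • p.1 + -β • p.2) + β • (- -β • p.1 + α • p.2))
        - f (α • (α • p.1 + -β • p.2) + β • b)) ^ 2 ∂μ := by
    intro p
    have e2 : α • (α • p.1 + -β • p.2) + β • (- -β • p.1 + α • p.2) = p.1 := by
      have : α • (α • p.1 + -β • p.2) + β • (- -β • p.1 + α • p.2)
        = (α ^ 2 + β ^ 2) • p.1 := by module
      rw [this, ha, hb]; simp
    rw [e2, neg_smul, ← sub_eq_add_neg]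
  simp_rw [e1]
  rw [hr, integral_prod _ (integrable_of_abs_le hG fun p =>
    abs_integral_le_of_abs_le fun b => hbd _ _)]
  have hin : ∀ D : E, ∫ B, ∫ b, (f (α • D + β • B) - f (α • D + β • b)) ^ 2 ∂μ ∂μ
      = 2 * ∫ B, f (α • D + β • B) ^ 2 ∂μ - 2 * (∫ B, f (α • D + β • B) ∂μ) ^ 2 := by
    intro D
    exact integral_integral_sub_sq (ν := μ) (f := fun B => f (α • D + β • B))
      (integrable_of_abs_le (by fun_prop) fun _ => hC _)
      (integrable_of_abs_le (by fun_prop) fun _ => abs_sq_le (hC _))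
  simp_rw [hin]
  have hm2 : Measurable fun A : E => ∫ y, f (α • A + β • y) ^ 2 ∂μ := by
    have : Measurable fun p : E × E => f (α • p.1 + β • p.2) ^ 2 := by fun_prop
    exact (this.stronglyMeasurable.integral_prod_right).measurable
  have hm3 : Measurable fun A : E => (∫ y, f (α • A + β • y) ∂μ) ^ 2 := by
    have : Measurable fun p : E × E => f (α • p.1 + β • p.2) := by fun_prop
    exact (this.stronglyMeasurable.integral_prod_right).measurable.pow_const 2
  have i2 := integrable_of_abs_le (ν := μ) hm2 (C := C ^ 2) fun A =>
    abs_integral_le_of_abs_le fun y => abs_sq_le (hC _)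
  have i3 := integrable_of_abs_le (ν := μ) hm3 (C := C ^ 2) fun A =>
    abs_sq_le (abs_integral_le_of_abs_le fun y => hC _)
  rw [integral_sub (by fun_prop) (by fun_prop), integral_const_mul, integral_const_mul,
    integral_integral_add_stdGaussian (δ := 1)
      (f := fun z => f z ^ 2) (by rw [ha, hb]; ring) (by fun_prop) (fun x => abs_sq_le (hC _)),
    gaussianCorr, sub_sub_cancel]
  simp only [one_smul]
  ring

end Stability


/-! ### Slope bounds without derivatives -/

section Slope

open Filter Topology

variable {E : Type*} [NormedAddCommGroup E]

/-- `h` controls the increments of `Φ`: over a segment, the slope of `Φ` is at most the mean of the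
values of `h` at the two end points. -/
def HasSlopeBound (Φ h : E → ℝ) : Prop :=
  ∀ x y, |Φ x - Φ y| ≤ ‖x - y‖ * ((h x + h y) / 2)

variable {Φ h : E → ℝ}

theorem HasSlopeBound.lipschitzOnWith (hΦ : HasSlopeBound Φ h) {s : Set E} {C : NNReal}
    (hC : ∀ x ∈ s, h x ≤ C) : LipschitzOnWith C Φ s := by
  refine LipschitzOnWith.of_dist_le_mul fun x hx y hy => ?_
  rw [Real.dist_eq, dist_eq_norm, mul_comm]
  refine (hΦ x y).trans ?_
  gcongr
  linarith [hC x hx, hC y hy]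

theorem HasSlopeBound.continuous (hΦ : HasSlopeBound Φ h) (hh : Continuous h) :
    Continuous Φ := by
  rw [continuous_iff_continuousAt]
  intro x
  rw [ContinuousAt, tendsto_iff_dist_tendsto_zero]
  have h1 : Tendsto (fun y => ‖y - x‖ * ((h y + h x) / 2)) (𝓝 x)
      (𝓝 (‖x - x‖ * ((h x + h x) / 2))) :=
    Continuous.tendsto (f := fun y => ‖y - x‖ * ((h y + h x) / 2)) (by fun_prop) x
  rw [sub_self, norm_zero, zero_mul] at h1
  exact squeeze_zero (fun _ => dist_nonneg) (fun y => by rw [Real.dist_eq]; exact hΦ y x) h1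

theorem HasSlopeBound.truncate (hΦ : HasSlopeBound Φ h) (K : ℝ) :
    HasSlopeBound (fun x => max (-K) (min K (Φ x))) h := fun x y => by
  refine le_trans ?_ (hΦ x y)
  refine (abs_max_sub_max_le_max _ _ _ _).trans ?_
  simp only [sub_self, abs_zero]
  refine max_le (abs_nonneg _) ((abs_min_sub_min_le_max _ _ _ _).trans ?_)
  simp

variable [NormedSpace ℝ E]

theorem HasSlopeBound.norm_fderiv_le (hΦ : HasSlopeBound Φ h) (hh : Continuous h)
    (h0 : ∀ x, 0 ≤ h x) {x : E} {f' : E →L[ℝ] ℝ} (hf : HasFDerivAt Φ f' x) : ‖f'‖ ≤ h x := by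
  refine le_of_forall_pos_le_add fun δ hδ => ?_
  refine hf.le_of_lip' (by linarith [h0 x]) ?_
  have h1 : ∀ᶠ y in 𝓝 x, h y < h x + δ :=
    hh.continuousAt.eventually_lt continuousAt_const (by linarith)
  filter_upwards [h1] with y hy
  rw [Real.norm_eq_abs, mul_comm]
  refine (hΦ y x).trans ?_
  gcongr
  linarith

/-- On each ball h is bounded, so Φ is Lipschitz there and Rademacher's theorem applies; countably
many balls cover the space. -/
theorem HasSlopeBound.ae_differentiableAt [FiniteDimensional ℝ E] [MeasurableSpace E]
    [BorelSpace E] (ν : Measure E) [ν.IsAddHaarMeasure] (hΦ : HasSlopeBound Φ h)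
    (hh : Continuous h) : ∀ᵐ x ∂ν, DifferentiableAt ℝ Φ x := by
  have : ∀ n : ℕ, ∀ᵐ x ∂ν, x ∈ Metric.ball (0 : E) n → DifferentiableAt ℝ Φ x := by
    intro n
    obtain ⟨C, hC⟩ := (isCompact_closedBall (0 : E) n).bddAbove_image hh.continuousOn
    have hL : LipschitzOnWith C.toNNReal Φ (Metric.ball 0 n) :=
      hΦ.lipschitzOnWith fun x hx => (hC ⟨x, Metric.ball_subset_closedBall hx, rfl⟩).trans
        (Real.le_coe_toNNReal C)
    filter_upwards [hL.ae_differentiableWithinAt_of_mem (μ := ν)] with x hx hxs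
    exact (hx hxs).differentiableAt (Metric.isOpen_ball.mem_nhds hxs)
  filter_upwards [ae_all_iff.2 this] with x hx
  obtain ⟨n, hn⟩ := exists_nat_gt ‖x‖
  exact hx n (by simpa using hn)

end Slope

/-! ### Gaussian Poincaré inequality -/

section Poincare

open Filter Topology

variable {E : Type*} [NormedAddCommGroup E] [InnerProductSpace ℝ E]

theorem norm_sq_smul_add_smul_le {a b : ℝ} (hab : a ^ 2 + b ^ 2 = 1) (u w : E) :
    ‖a • u + b • w‖ ^ 2 ≤ ‖u‖ ^ 2 + ‖w‖ ^ 2 := by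
  have h : ‖a • u + b • w‖ ≤ |a| * ‖u‖ + |b| * ‖w‖ := by
    refine (norm_add_le _ _).trans ?_
    rw [norm_smul, norm_smul, Real.norm_eq_abs, Real.norm_eq_abs]
  have h2 : ‖a • u + b • w‖ ^ 2 ≤ (|a| * ‖u‖ + |b| * ‖w‖) ^ 2 := by gcongr
  have h3 : |a| ^ 2 + |b| ^ 2 = 1 := by simpa using hab
  nlinarith [sq_nonneg (|a| * ‖w‖ - |b| * ‖u‖)]

/-- The sum of the squared norms of three vectors. -/
def sumSq (p : (E × E) × E) : ℝ := ‖p.1.1‖ ^ 2 + ‖p.1.2‖ ^ 2 + ‖p.2‖ ^ 2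

omit [InnerProductSpace ℝ E] in
theorem sumSq_nonneg (p : (E × E) × E) : 0 ≤ sumSq p := by unfold sumSq; positivity

variable {Φ h : E → ℝ}

/-- Domination for the limit of the scaled increments. The two points differ by b times a vector of
squared norm at most 3 `sumSq`, and both lie in the ball of squared radius `sumSq`. With b² =
2^{-k}, the factor b² cancels the scaling 2^k. -/
theorem HasSlopeBound.sq_increment_le (hΦ : HasSlopeBound Φ h) (h0 : ∀ x, 0 ≤ h x) {C c : ℝ}
    (hc0 : 0 ≤ c) (hb : ∀ x, h x ≤ C * Real.exp (c * ‖x‖ ^ 2)) {a b : ℝ}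
    (hab : a ^ 2 + b ^ 2 = 1) (p : (E × E) × E) :
    (Φ p.1.1 - Φ (a • (a • p.1.1 - b • p.1.2) + b • p.2)) ^ 2
      ≤ b ^ 2 * (3 * C ^ 2 * sumSq p * Real.exp (2 * c * sumSq p)) := by
  obtain ⟨⟨x, z⟩, w⟩ := p
  simp only
  set S := sumSq ((x, z), w) with hS
  have hSd : S = ‖x‖ ^ 2 + ‖z‖ ^ 2 + ‖w‖ ^ 2 := rfl
  set y := a • (a • x - b • z) + b • w with hy
  have hC0 : 0 ≤ C := by
    have := (h0 0).trans (hb 0)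
    simpa using this
  have hyS : ‖y‖ ^ 2 ≤ S := by
    have h1 := norm_sq_smul_add_smul_le hab (a • x - b • z) w
    have h2 := norm_sq_smul_add_smul_le (a := a) (b := -b) (by simpa using hab) x z
    rw [neg_smul, ← sub_eq_add_neg] at h2
    rw [hSd]
    linarith
  have hxS : ‖x‖ ^ 2 ≤ S := by rw [hSd]; nlinarith [sq_nonneg ‖z‖, sq_nonneg ‖w‖]
  have hbd : ∀ u : E, ‖u‖ ^ 2 ≤ S → h u ≤ C * Real.exp (c * S) := fun u hu =>
    (hb u).trans (by gcongr)
  have hmean : (h x + h y) / 2 ≤ C * Real.exp (c * S) := by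
    linarith [hbd x hxS, hbd y hyS]
  have hmean0 : 0 ≤ (h x + h y) / 2 := by linarith [h0 x, h0 y]
  have hdiff : x - y = b • (b • x + a • z - w) := by
    have : x - y = (a ^ 2 + b ^ 2) • x - y := by rw [hab, one_smul]
    rw [this, hy]; module
  have hn : ‖b • x + a • z - w‖ ^ 2 ≤ 3 * S := by
    have ha1 : |a| ≤ 1 := by rw [← sq_le_one_iff_abs_le_one]; nlinarith [sq_nonneg b]
    have hb1 : |b| ≤ 1 := by rw [← sq_le_one_iff_abs_le_one]; nlinarith [sq_nonneg a]
    have h1 : ‖b • x + a • z - w‖ ≤ ‖x‖ + ‖z‖ + ‖w‖ := by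
      refine (norm_sub_le _ _).trans ?_
      gcongr
      refine (norm_add_le _ _).trans ?_
      rw [norm_smul, norm_smul, Real.norm_eq_abs, Real.norm_eq_abs]
      gcongr
      · exact mul_le_of_le_one_left (norm_nonneg _) hb1
      · exact mul_le_of_le_one_left (norm_nonneg _) ha1
    have h2 : ‖b • x + a • z - w‖ ^ 2 ≤ (‖x‖ + ‖z‖ + ‖w‖) ^ 2 := by gcongr
    rw [hSd]
    nlinarith [sq_nonneg (‖x‖ - ‖z‖), sq_nonneg (‖x‖ - ‖w‖), sq_nonneg (‖z‖ - ‖w‖)]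
  calc (Φ x - Φ y) ^ 2 = |Φ x - Φ y| ^ 2 := (sq_abs _).symm
    _ ≤ (‖x - y‖ * ((h x + h y) / 2)) ^ 2 := by gcongr; exact hΦ x y
    _ = ‖x - y‖ ^ 2 * ((h x + h y) / 2) ^ 2 := by ring
    _ ≤ (b ^ 2 * (3 * S)) * (C * Real.exp (c * S)) ^ 2 := by
        have h1 : ‖x - y‖ ^ 2 ≤ b ^ 2 * (3 * S) := by
          rw [hdiff, norm_smul, mul_pow, Real.norm_eq_abs, sq_abs]
          gcongr
        have h2 : ((h x + h y) / 2) ^ 2 ≤ (C * Real.exp (c * S)) ^ 2 := by gcongr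
        exact mul_le_mul h1 h2 (sq_nonneg _) ((sq_nonneg _).trans h1)
    _ = _ := by
        rw [mul_pow, ← Real.exp_nat_mul]
        push_cast
        ring_nf

/-- With a² + b² = 1, the second point is x + b(-bx - az + w), so the increment divided by b tends
to f' applied to w - z. -/
theorem tendsto_scaled_increment {f' : E →L[ℝ] ℝ} {x z w : E} (hf : HasFDerivAt Φ f' x) :
    Tendsto (fun k : ℕ => 2 ^ k * (Φ x - Φ (√(1 - (1 / 2) ^ k) • (√(1 - (1 / 2) ^ k) • x
      - √((1 / 2) ^ k) • z) + √((1 / 2) ^ k) • w)) ^ 2) atTop (𝓝 ((f' z - f' w) ^ 2)) := by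
  have hp : Tendsto (fun k : ℕ => ((1 : ℝ) / 2) ^ k) atTop (𝓝 0) :=
    tendsto_pow_atTop_nhds_zero_of_lt_one (by norm_num) (by norm_num)
  have hb : Tendsto (fun k : ℕ => √(((1 : ℝ) / 2) ^ k)) atTop (𝓝 0) := by
    have := (Real.continuous_sqrt.tendsto 0).comp hp
    rwa [Real.sqrt_zero] at this
  have ha : Tendsto (fun k : ℕ => √(1 - ((1 : ℝ) / 2) ^ k)) atTop (𝓝 1) := by
    have : Tendsto (fun k : ℕ => 1 - ((1 : ℝ) / 2) ^ k) atTop (𝓝 (1 - 0)) :=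
      tendsto_const_nhds.sub hp
    have := (Real.continuous_sqrt.tendsto (1 - 0)).comp this
    rwa [sub_zero, Real.sqrt_one] at this
  have hv : Tendsto (fun k : ℕ => -√(((1 : ℝ) / 2) ^ k) • x - √(1 - ((1 : ℝ) / 2) ^ k) • z + w)
      atTop (𝓝 (-(0 : ℝ) • x - (1 : ℝ) • z + w)) :=
    ((hb.neg.smul_const x).sub (ha.smul_const z)).add_const w
  have hd0 : Tendsto (fun k : ℕ => √(((1 : ℝ) / 2) ^ k) •
      (-√(((1 : ℝ) / 2) ^ k) • x - √(1 - ((1 : ℝ) / 2) ^ k) • z + w)) atTop (𝓝 0) := by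
    simpa using hb.smul hv
  have hb0 : ∀ k : ℕ, √(((1 : ℝ) / 2) ^ k) ≠ 0 := fun k => by positivity
  have hlim := (hasFDerivWithinAt_univ.2 hf).lim (c := fun k : ℕ => (√(((1 : ℝ) / 2) ^ k))⁻¹)
    hd0 (.of_forall fun _ => Set.mem_univ _) (v := -(0 : ℝ) • x - (1 : ℝ) • z + w) (by
      refine hv.congr fun k => ?_
      rw [smul_smul, inv_mul_cancel₀ (hb0 k), one_smul])
  have h2 := hlim.pow 2
  have e : (f' (-(0 : ℝ) • x - (1 : ℝ) • z + w)) ^ 2 = (f' z - f' w) ^ 2 := by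
    simp; ring
  rw [e] at h2
  refine h2.congr fun k => ?_
  have hb2 : √(((1 : ℝ) / 2) ^ k) ^ 2 = (1 / 2) ^ k := Real.sq_sqrt (by positivity)
  have ha2 : √(1 - ((1 : ℝ) / 2) ^ k) ^ 2 = 1 - (1 / 2) ^ k :=
    Real.sq_sqrt (sub_nonneg.2 (pow_le_one₀ (by norm_num) (by norm_num)))
  have ex : x + √(((1 : ℝ) / 2) ^ k) •
      (-√(((1 : ℝ) / 2) ^ k) • x - √(1 - ((1 : ℝ) / 2) ^ k) • z + w)
      = √(1 - (1 / 2) ^ k) • (√(1 - (1 / 2) ^ k) • x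
      - √((1 / 2) ^ k) • z) + √((1 / 2) ^ k) • w := by
    have e1 : x + √(((1 : ℝ) / 2) ^ k) •
        (-√(((1 : ℝ) / 2) ^ k) • x - √(1 - ((1 : ℝ) / 2) ^ k) • z + w)
        = (1 - √(((1 : ℝ) / 2) ^ k) ^ 2) • x
          - (√(((1 : ℝ) / 2) ^ k) * √(1 - ((1 : ℝ) / 2) ^ k)) • z + √((1 / 2) ^ k) • w := by
      module
    have e2 : √(1 - ((1 : ℝ) / 2) ^ k) • (√(1 - ((1 : ℝ) / 2) ^ k) • x
        - √(((1 : ℝ) / 2) ^ k) • z) + √(((1 : ℝ) / 2) ^ k) • w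
        = (√(1 - ((1 : ℝ) / 2) ^ k) ^ 2) • x
          - (√(((1 : ℝ) / 2) ^ k) * √(1 - ((1 : ℝ) / 2) ^ k)) • z + √((1 / 2) ^ k) • w := by
      module
    rw [e1, e2, hb2, ha2]
  rw [ex, smul_eq_mul, mul_pow, inv_pow, hb2, one_div, inv_pow, inv_inv]
  ring

variable [FiniteDimensional ℝ E] [MeasurableSpace E] [BorelSpace E]

theorem integrable_sumSq_mul_exp {c : ℝ} (hc : c < 1 / 4) (K : ℝ) :
    Integrable (fun p : (E × E) × E => K * sumSq p * Real.exp (2 * c * sumSq p))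
      (((stdGaussian E).prod (stdGaussian E)).prod (stdGaussian E)) := by
  -- The exponent 2c + δ stays below the Gaussian threshold 1/2, and the slack δ absorbs the factor
  -- `sumSq`.
  set δ := 1 / 4 - c with hδ
  have hδ0 : 0 < δ := by linarith
  have h1 : Integrable (fun x : E => Real.exp ((2 * c + δ) * ‖x‖ ^ 2)) (stdGaussian E) := by
    simpa using integrable_exp_sq_norm_stdGaussian (E := E) (c := 2 * c + δ) (s := 1)
      (by linarith) 0
  have h2 := ((h1.mul_prod h1).mul_prod h1).const_mul (|K| / δ)
  refine h2.mono' (by unfold sumSq; fun_prop) (.of_forall fun p => ?_)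
  have e : Real.exp ((2 * c + δ) * ‖p.1.1‖ ^ 2) * Real.exp ((2 * c + δ) * ‖p.1.2‖ ^ 2)
      * Real.exp ((2 * c + δ) * ‖p.2‖ ^ 2) = Real.exp (δ * sumSq p) * Real.exp (2 * c * sumSq p) := by
    rw [← Real.exp_add, ← Real.exp_add, ← Real.exp_add, sumSq]
    ring_nf
  rw [e, Real.norm_eq_abs, abs_mul, abs_mul, abs_of_nonneg (sumSq_nonneg p), Real.abs_exp,
    ← mul_assoc]
  refine mul_le_mul_of_nonneg_right ?_ (Real.exp_nonneg _)
  have : δ * sumSq p ≤ Real.exp (δ * sumSq p) := by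
    linarith [Real.add_one_le_exp (δ * sumSq p)]
  rw [div_mul_eq_mul_div, le_div_iff₀ hδ0]
  nlinarith [abs_nonneg K]

theorem integral_sq_sub_dual_stdGaussian (L : StrongDual ℝ E) :
    ∫ z, ∫ w, (L z - L w) ^ 2 ∂(stdGaussian E) ∂(stdGaussian E) = 2 * ‖L‖ ^ 2 := by
  have hm := IsGaussian.memLp_dual (stdGaussian E) L 2 (by simp)
  rw [integral_integral_sub_sq (IsGaussian.integrable_dual _ L) hm.integrable_sq,
    integral_strongDual_stdGaussian, ← variance_dual_stdGaussian L, variance_eq_sub hm,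
    integral_strongDual_stdGaussian]
  simp

theorem HasSlopeBound.poincare_of_bounded (hΦ : HasSlopeBound Φ h) (hh : Continuous h)
    (h0 : ∀ x, 0 ≤ h x) {C c : ℝ} (hc0 : 0 ≤ c) (hc : c < 1 / 4)
    (hb : ∀ x, h x ≤ C * Real.exp (c * ‖x‖ ^ 2)) {K : ℝ} (hK : ∀ x, |Φ x| ≤ K) :
    ∫ x, Φ x ^ 2 ∂(stdGaussian E) - (∫ x, Φ x ∂(stdGaussian E)) ^ 2
      ≤ ∫ x, h x ^ 2 ∂(stdGaussian E) := by
  set μ := stdGaussian E with hμ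
  have hΦm : Measurable Φ := (hΦ.continuous hh).measurable
  have hdiff : ∀ᵐ x ∂μ, DifferentiableAt ℝ Φ x :=
    stdGaussian_absolutelyContinuous.ae_le (hΦ.ae_differentiableAt volume hh)
  have hdiff3 : ∀ᵐ p ∂((μ.prod μ).prod μ), DifferentiableAt ℝ Φ p.1.1 :=
    Measure.quasiMeasurePreserving_fst.ae (Measure.quasiMeasurePreserving_fst.ae hdiff)
  set G : ℕ → (E × E) × E → ℝ := fun k p => 2 ^ k * (Φ p.1.1 - Φ (√(1 - (1 / 2) ^ k) •
    (√(1 - (1 / 2) ^ k) • p.1.1 - √((1 / 2) ^ k) • p.1.2) + √((1 / 2) ^ k) • p.2)) ^ 2 with hG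
  set G' : (E × E) × E → ℝ := fun p => (fderiv ℝ Φ p.1.1 p.1.2 - fderiv ℝ Φ p.1.1 p.2) ^ 2
    with hG'
  set bd : (E × E) × E → ℝ := fun p => 3 * C ^ 2 * sumSq p * Real.exp (2 * c * sumSq p) with hbd
  have hbdi : Integrable bd ((μ.prod μ).prod μ) := integrable_sumSq_mul_exp hc _
  have hGm : ∀ k, Measurable (G k) := fun k => by fun_prop
  have hGbd : ∀ k p, ‖G k p‖ ≤ bd p := by
    intro k p
    have hp1 : ((1 : ℝ) / 2) ^ k ≤ 1 := pow_le_one₀ (by norm_num) (by norm_num)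
    have hb2 : √(((1 : ℝ) / 2) ^ k) ^ 2 = (1 / 2) ^ k := Real.sq_sqrt (by positivity)
    have ha2 : √(1 - ((1 : ℝ) / 2) ^ k) ^ 2 = 1 - (1 / 2) ^ k :=
      Real.sq_sqrt (sub_nonneg.2 hp1)
    have h1 := hΦ.sq_increment_le h0 hc0 hb (a := √(1 - ((1 : ℝ) / 2) ^ k))
      (b := √(((1 : ℝ) / 2) ^ k)) (by rw [ha2, hb2]; ring) p
    rw [hb2] at h1
    rw [Real.norm_eq_abs, abs_of_nonneg (by positivity)]
    calc G k p ≤ 2 ^ k * ((1 / 2) ^ k * bd p) := by simp only [hG]; gcongr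
      _ = bd p := by rw [← mul_assoc, ← mul_pow]; norm_num
  have hlim : ∀ᵐ p ∂((μ.prod μ).prod μ), Tendsto (fun k => G k p) atTop (𝓝 (G' p)) := by
    filter_upwards [hdiff3] with p hp
    exact tendsto_scaled_increment hp.hasFDerivAt
  have hG'bd : ∀ᵐ p ∂((μ.prod μ).prod μ), ‖G' p‖ ≤ bd p := by
    filter_upwards [hlim] with p hp
    exact le_of_tendsto hp.norm (.of_forall fun k => hGbd k p)
  -- Measurability is inherited from the approximants, as an almost everywhere limit.
  have hG'm : AEStronglyMeasurable G' ((μ.prod μ).prod μ) :=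
    aestronglyMeasurable_of_tendsto_ae atTop (fun k => (hGm k).aestronglyMeasurable) hlim
  have hG'i : Integrable G' ((μ.prod μ).prod μ) := hbdi.mono' hG'm hG'bd
  have hconv := tendsto_integral_of_dominated_convergence bd
    (fun k => (hGm k).aestronglyMeasurable) hbdi (fun k => .of_forall (hGbd k)) hlim
  have hle : ∫ x, Φ x ^ 2 ∂μ - (∫ x, Φ x ∂μ) ^ 2 ≤ 1 / 2 * ∫ p, G' p ∂((μ.prod μ).prod μ) := by
    refine ge_of_tendsto (hconv.const_mul (1 / 2)) (.of_forall fun k => ?_)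
    refine (sub_sq_integral_le_gaussianCorr hΦm hK k).trans_eq ?_
    rw [sub_gaussianCorr_eq hΦm hK (by positivity) (pow_le_one₀ (by norm_num) (by norm_num)),
      integral_const_mul]
    ring
  have hh2 : Integrable (fun x => h x ^ 2) μ := by
    have h1 : Integrable (fun x : E => Real.exp (2 * c * ‖x‖ ^ 2)) μ := by
      simpa using integrable_exp_sq_norm_stdGaussian (E := E) (c := 2 * c) (s := 1)
        (by linarith) 0
    refine (h1.const_mul (C ^ 2)).mono' (by fun_prop) (.of_forall fun x => ?_)
    have := pow_le_pow_left₀ (h0 x) (hb x) 2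
    rw [Real.norm_eq_abs, abs_of_nonneg (by positivity)]
    refine this.trans_eq ?_
    rw [mul_pow, ← Real.exp_nat_mul]
    push_cast
    ring_nf
  have hG'int : ∫ p, G' p ∂((μ.prod μ).prod μ) = ∫ x, 2 * ‖fderiv ℝ Φ x‖ ^ 2 ∂μ := by
    rw [integral_prod _ hG'i, integral_prod _ hG'i.integral_prod_left]
    exact integral_congr_ae (.of_forall fun x =>
      integral_sq_sub_dual_stdGaussian (fderiv ℝ Φ x))
  refine hle.trans ?_
  rw [hG'int, integral_const_mul, ← mul_assoc, one_div, inv_mul_cancel₀ two_ne_zero, one_mul]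
  refine integral_mono_of_nonneg (.of_forall fun x => by positivity) hh2 ?_
  filter_upwards [hdiff] with x hx
  exact pow_le_pow_left₀ (norm_nonneg _) (hΦ.norm_fderiv_le hh h0 hx.hasFDerivAt) 2

/-- The Gaussian Poincaré inequality. -/
theorem HasSlopeBound.poincare (hΦ : HasSlopeBound Φ h) (hh : Continuous h)
    (h0 : ∀ x, 0 ≤ h x) {C c : ℝ} (hc0 : 0 ≤ c) (hc : c < 1 / 4)
    (hb : ∀ x, h x ≤ C * Real.exp (c * ‖x‖ ^ 2)) (hL2 : MemLp Φ 2 (stdGaussian E)) :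
    ∫ x, Φ x ^ 2 ∂(stdGaussian E) - (∫ x, Φ x ∂(stdGaussian E)) ^ 2
      ≤ ∫ x, h x ^ 2 ∂(stdGaussian E) := by
  -- Truncation at level n is 1-Lipschitz, so it keeps the slope bound; dominated convergence then
  -- removes boundedness.
  set f : ℕ → E → ℝ := fun n x => max (-(n : ℝ)) (min n (Φ x)) with hf
  have hΦc := hΦ.continuous hh
  have hfm : ∀ n, Measurable (f n) := fun n => by
    have : Continuous (f n) := by fun_prop
    exact this.measurable
  have hfn : ∀ n x, |f n x| ≤ n := fun n x => by
    have hn : (0 : ℝ) ≤ n := n.cast_nonneg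
    rw [abs_le]
    exact ⟨le_max_left _ _, max_le (by linarith) (min_le_left _ _)⟩
  have hfΦ : ∀ n x, |f n x| ≤ |Φ x| := fun n x => by
    have hn : (0 : ℝ) ≤ n := n.cast_nonneg
    rw [abs_le]
    constructor
    · refine le_max_of_le_right (le_min ?_ (neg_abs_le _))
      linarith [abs_nonneg (Φ x)]
    · exact max_le (by linarith [abs_nonneg (Φ x)]) ((min_le_right _ _).trans (le_abs_self _))
  have hlim : ∀ x, Tendsto (fun n => f n x) atTop (𝓝 (Φ x)) := fun x => by
    obtain ⟨N, hN⟩ := exists_nat_ge |Φ x|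
    refine tendsto_const_nhds.congr' ?_
    filter_upwards [eventually_ge_atTop N] with n hn
    have hn' : |Φ x| ≤ n := hN.trans (by exact_mod_cast hn)
    have := abs_le.1 hn'
    simp only [hf]
    rw [min_eq_right this.2, max_eq_right this.1]
  have hi1 := (hL2.integrable one_le_two).abs
  have hi2 := hL2.integrable_sq
  have l1 := tendsto_integral_of_dominated_convergence (μ := stdGaussian E) _
    (fun n => (hfm n).aestronglyMeasurable) hi1 (fun n => .of_forall (hfΦ n)) (.of_forall hlim)
  have l2 := tendsto_integral_of_dominated_convergence (μ := stdGaussian E)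
    (F := fun n x => f n x ^ 2) (f := fun x => Φ x ^ 2) _
    (fun n => ((hfm n).pow_const 2).aestronglyMeasurable) hi2 (fun n => .of_forall fun x => by
      rw [Real.norm_eq_abs, abs_pow, ← sq_abs (Φ x)]
      have := hfΦ n x
      gcongr) (.of_forall fun x => (hlim x).pow 2)
  exact le_of_tendsto (l2.sub (l1.pow 2)) (.of_forall fun n =>
    (hΦ.truncate n).poincare_of_bounded hh h0 hc0 hc hb (hfn n))

end Poincare


/-! ### Markov operator of the chain: growth, coupling, one-step Poincaré -/

section Kernel

open Filter Topology Module

variable {E : Type*} [NormedAddCommGroup E]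

/-- Hypotheses on one step `x ↦ T x + √(2γ) w` of the chain: its drift `T` fixes `0` and contracts
squared distances by the factor `1 - κ γ`. -/
structure IsLangevinStep (T : E → E) (κ γ : ℝ) : Prop where
  kappa_pos : 0 < κ
  step_pos : 0 < γ
  mul_lt_one : κ * γ < 1
  map_zero : T 0 = 0
  contract : ∀ x y, ‖T x - T y‖ ^ 2 ≤ (1 - κ * γ) * ‖x - y‖ ^ 2

/-- Continuous functions that grow at most like `exp (c ‖x‖²)`. -/
def HasGaussianGrowth (c : ℝ) (f : E → ℝ) : Prop :=
  Continuous f ∧ ∃ C, ∀ x, |f x| ≤ C * Real.exp (c * ‖x‖ ^ 2)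

section Growth

variable {T : E → E} {κ γ c : ℝ} {f g : E → ℝ}

theorem IsLangevinStep.norm_sq_le (hT : IsLangevinStep T κ γ) (x : E) :
    ‖T x‖ ^ 2 ≤ (1 - κ * γ) * ‖x‖ ^ 2 := by
  simpa [hT.map_zero] using hT.contract x 0

theorem IsLangevinStep.norm_sub_le (hT : IsLangevinStep T κ γ) (x y : E) :
    ‖T x - T y‖ ≤ √(1 - κ * γ) * ‖x - y‖ := by
  have h := Real.sqrt_le_sqrt (hT.contract x y)
  rwa [Real.sqrt_sq (norm_nonneg _), Real.sqrt_mul (by linarith [hT.mul_lt_one]),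
    Real.sqrt_sq (norm_nonneg _)] at h

theorem IsLangevinStep.continuous (hT : IsLangevinStep T κ γ) : Continuous T :=
  (LipschitzWith.of_dist_le_mul (K := ⟨√(1 - κ * γ), Real.sqrt_nonneg _⟩) fun x y => by
    rw [dist_eq_norm, dist_eq_norm]; exact hT.norm_sub_le x y).continuous

theorem IsLangevinStep.lt_one_of_le (hT : IsLangevinStep T κ γ) (hc : 4 * c ≤ κ) :
    4 * c * γ < 1 :=
  (mul_le_mul_of_nonneg_right hc hT.step_pos.le).trans_lt hT.mul_lt_one

theorem norm_add_sq_le_two_mul (u v : E) : ‖u + v‖ ^ 2 ≤ 2 * ‖u‖ ^ 2 + 2 * ‖v‖ ^ 2 := by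
  have h := pow_le_pow_left₀ (norm_nonneg _) (norm_add_le u v) 2
  nlinarith [sq_nonneg (‖u‖ - ‖v‖)]

theorem HasGaussianGrowth.add (hf : HasGaussianGrowth c f) (hg : HasGaussianGrowth c g) :
    HasGaussianGrowth c (fun x => f x + g x) := by
  obtain ⟨hf, C, hC⟩ := hf
  obtain ⟨hg, D, hD⟩ := hg
  refine ⟨hf.add hg, C + D, fun x => (abs_add_le _ _).trans ?_⟩
  rw [add_mul]
  exact add_le_add (hC x) (hD x)

theorem HasGaussianGrowth.const_mul (hf : HasGaussianGrowth c f) (a : ℝ) :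
    HasGaussianGrowth c (fun x => a * f x) := by
  obtain ⟨hf, C, hC⟩ := hf
  refine ⟨hf.const_mul a, |a| * C, fun x => ?_⟩
  rw [abs_mul, mul_assoc]
  exact mul_le_mul_of_nonneg_left (hC x) (abs_nonneg _)

theorem HasGaussianGrowth.sq (hf : HasGaussianGrowth c f) :
    HasGaussianGrowth (2 * c) (fun x => f x ^ 2) := by
  obtain ⟨hf, C, hC⟩ := hf
  refine ⟨hf.pow 2, C ^ 2, fun x => ?_⟩
  rw [abs_pow]
  refine (pow_le_pow_left₀ (abs_nonneg _) (hC x) 2).trans_eq ?_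
  rw [mul_pow, ← Real.exp_nat_mul]
  push_cast
  ring_nf

theorem HasGaussianGrowth.sum {ι : Type*} (s : Finset ι) {F : ι → E → ℝ}
    (hF : ∀ i ∈ s, HasGaussianGrowth c (F i)) : HasGaussianGrowth c (fun x => ∑ i ∈ s, F i x) := by
  classical
  induction s using Finset.induction_on with
  | empty => exact ⟨by simpa using continuous_const, 0, fun x => by simp⟩
  | insert i s hi ih =>
    simp_rw [Finset.sum_insert hi]
    exact (hF i (by simp)).add (ih fun j hj => hF j (by simp [hj]))

end Growth

variable [InnerProductSpace ℝ E] [FiniteDimensional ℝ E] [MeasurableSpace E] [BorelSpace E]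

/-- The Markov operator of the chain `x ↦ T x + √(2γ) w` with standard Gaussian `w`. -/
noncomputable def langevinOp (T : E → E) (γ : ℝ) (f : E → ℝ) (x : E) : ℝ :=
  ∫ w, f (T x + √(2 * γ) • w) ∂(stdGaussian E)

/-- The law after `k` steps of the chain started at `0`. -/
noncomputable def chainLaw (T : E → E) (γ : ℝ) : ℕ → Measure E
  | 0 => Measure.dirac 0
  | k + 1 => ((chainLaw T γ k).prod (stdGaussian E)).map fun p => T p.1 + √(2 * γ) • p.2

variable {T : E → E} {κ γ c : ℝ} {f g : E → ℝ}

theorem IsLangevinStep.isProbabilityMeasure_chainLaw (hT : IsLangevinStep T κ γ) (k : ℕ) :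
    IsProbabilityMeasure (chainLaw T γ k) := by
  induction k with
  | zero => rw [chainLaw]; infer_instance
  | succ k ih =>
    rw [chainLaw]
    have := hT.continuous
    exact Measure.isProbabilityMeasure_map (by fun_prop)

theorem two_mul_sq_sqrt (hγ : 0 < γ) : 2 * c * √(2 * γ) ^ 2 = 4 * c * γ := by
  rw [Real.sq_sqrt (by positivity)]; ring

theorem IsLangevinStep.integrable_exp (hT : IsLangevinStep T κ γ) (hc : 4 * c ≤ κ) (b : E) :
    Integrable (fun w => Real.exp (c * ‖b + √(2 * γ) • w‖ ^ 2)) (stdGaussian E) :=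
  integrable_exp_sq_norm_stdGaussian
    (by rw [two_mul_sq_sqrt hT.step_pos]; exact hT.lt_one_of_le hc) b

theorem IsLangevinStep.integral_exp (hT : IsLangevinStep T κ γ) (hc : 4 * c ≤ κ) (b : E) :
    ∫ w, Real.exp (c * ‖b + √(2 * γ) • w‖ ^ 2) ∂(stdGaussian E)
      = (1 - 4 * c * γ) ^ (-(finrank ℝ E / 2 : ℝ)) * Real.exp (c * ‖b‖ ^ 2 / (1 - 4 * c * γ)) := by
  rw [integral_exp_sq_norm_stdGaussian
    (by rw [two_mul_sq_sqrt hT.step_pos]; exact hT.lt_one_of_le hc) b, two_mul_sq_sqrt hT.step_pos]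

omit [InnerProductSpace ℝ E] [FiniteDimensional ℝ E] [MeasurableSpace E] [BorelSpace E] in
-- The Gaussian step inflates the exponent c by 1/(1 - 4cγ) and the contraction shrinks it by 1 -
-- κγ; 4c ≤ κ makes the net effect at most 1. Hence the operator keeps the exponent c in growth
-- bounds.
theorem IsLangevinStep.exp_le (hT : IsLangevinStep T κ γ) (hc0 : 0 ≤ c) (hc : 4 * c ≤ κ) (x : E) :
    Real.exp (c * ‖T x‖ ^ 2 / (1 - 4 * c * γ)) ≤ Real.exp (c * ‖x‖ ^ 2) := by
  have hD : 0 < 1 - 4 * c * γ := by linarith [hT.lt_one_of_le hc]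
  refine Real.exp_le_exp.2 ?_
  rw [div_le_iff₀ hD, mul_assoc]
  refine mul_le_mul_of_nonneg_left ((hT.norm_sq_le x).trans ?_) hc0
  rw [mul_comm]
  refine mul_le_mul_of_nonneg_left ?_ (sq_nonneg _)
  nlinarith [hT.step_pos]

theorem IsLangevinStep.integrable (hT : IsLangevinStep T κ γ) (hc : 4 * c ≤ κ)
    (hf : HasGaussianGrowth c f) (b : E) :
    Integrable (fun w => f (b + √(2 * γ) • w)) (stdGaussian E) := by
  obtain ⟨hfc, C, hC⟩ := hf
  exact ((hT.integrable_exp hc b).const_mul C).mono' (by fun_prop) (.of_forall fun w => hC _)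

theorem IsLangevinStep.abs_langevinOp_le (hT : IsLangevinStep T κ γ) (hc0 : 0 ≤ c)
    (hc : 4 * c ≤ κ) {C : ℝ} (hC : ∀ x, |f x| ≤ C * Real.exp (c * ‖x‖ ^ 2)) (x : E) :
    |langevinOp T γ f x|
      ≤ C * (1 - 4 * c * γ) ^ (-(finrank ℝ E / 2 : ℝ)) * Real.exp (c * ‖x‖ ^ 2) := by
  have hC0 : 0 ≤ C := by
    have := (abs_nonneg _).trans (hC 0)
    simpa using this
  have hD : 0 < 1 - 4 * c * γ := by linarith [hT.lt_one_of_le hc]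
  calc |langevinOp T γ f x|
      ≤ ∫ w, C * Real.exp (c * ‖T x + √(2 * γ) • w‖ ^ 2) ∂(stdGaussian E) :=
        norm_integral_le_of_norm_le (f := fun w => f (T x + √(2 * γ) • w))
          ((hT.integrable_exp hc (T x)).const_mul C) (.of_forall fun w => hC _)
    _ = C * (1 - 4 * c * γ) ^ (-(finrank ℝ E / 2 : ℝ))
        * Real.exp (c * ‖T x‖ ^ 2 / (1 - 4 * c * γ)) := by
        rw [integral_const_mul, hT.integral_exp hc, ← mul_assoc]
    _ ≤ _ := by
        refine mul_le_mul_of_nonneg_left (hT.exp_le hc0 hc x) ?_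
        positivity

theorem IsLangevinStep.hasGaussianGrowth_langevinOp (hT : IsLangevinStep T κ γ) (hc0 : 0 ≤ c)
    (hc : 8 * c ≤ κ) (hf : HasGaussianGrowth c f) :
    HasGaussianGrowth c (langevinOp T γ f) := by
  obtain ⟨hfc, C, hC⟩ := hf
  have hc' : 4 * c ≤ κ := by linarith
  refine ⟨?_, _, hT.abs_langevinOp_le hc0 hc' hC⟩
  have hC0 : 0 ≤ C := by
    have := (abs_nonneg _).trans (hC 0)
    simpa using this
  rw [continuous_iff_continuousAt]
  intro x₀
  have hTc := hT.continuous
  have hev : ∀ᶠ x in 𝓝 x₀, ‖T x‖ ^ 2 < ‖T x₀‖ ^ 2 + 1 :=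
    (by fun_prop : Continuous fun x => ‖T x‖ ^ 2).continuousAt.eventually_lt continuousAt_const
      (by linarith)
  -- A dominating function uniform in x near x₀ costs a doubling of the exponent, through ‖u + v‖² ≤
  -- 2‖u‖² + 2‖v‖²; this is why 8c ≤ κ is needed.
  refine continuousAt_of_dominated (bound := fun w => C * Real.exp (2 * c * (‖T x₀‖ ^ 2 + 1)) *
    Real.exp ((2 * c) * ‖(0 : E) + √(2 * γ) • w‖ ^ 2)) ?_ ?_ ?_ ?_
  · exact .of_forall fun x => by fun_prop
  · filter_upwards [hev] with x hx
    refine .of_forall fun w => (hC _).trans ?_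
    rw [mul_assoc, ← Real.exp_add]
    gcongr
    have h1 := norm_add_sq_le_two_mul (T x) (√(2 * γ) • w)
    rw [zero_add]
    nlinarith
  · exact (hT.integrable_exp (c := 2 * c) (by linarith) 0).const_mul _
  · exact .of_forall fun w => by fun_prop

omit [BorelSpace E] in
theorem langevinOp_nonneg (hf : ∀ x, 0 ≤ f x) (x : E) : 0 ≤ langevinOp T γ f x :=
  integral_nonneg fun _ => hf _

theorem IsLangevinStep.langevinOp_sum (hT : IsLangevinStep T κ γ) (hc : 4 * c ≤ κ) {ι : Type*}
    (s : Finset ι) {F : ι → E → ℝ} (hF : ∀ i ∈ s, HasGaussianGrowth c (F i)) (a : ι → ℝ) (x : E) :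
    langevinOp T γ (fun x => ∑ i ∈ s, a i * F i x) x = ∑ i ∈ s, a i * langevinOp T γ (F i) x := by
  unfold langevinOp
  rw [integral_finsetSum]
  · simp_rw [integral_const_mul]
  · exact fun i hi => (hT.integrable hc (hF i hi) _).const_mul _

/-- Synchronous coupling: with the same noise from x and y, the distance after one step is exactly
‖T x - T y‖. -/
theorem IsLangevinStep.hasSlopeBound_langevinOp (hT : IsLangevinStep T κ γ) (hc : 4 * c ≤ κ)
    (hf : HasGaussianGrowth c f) (hg : HasGaussianGrowth c g) (hg0 : ∀ x, 0 ≤ g x)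
    (hfg : HasSlopeBound f g) :
    HasSlopeBound (langevinOp T γ f) (fun x => √(1 - κ * γ) * langevinOp T γ g x) := by
  intro x y
  have i1 := hT.integrable hc hf (T x)
  have i2 := hT.integrable hc hf (T y)
  have j1 := hT.integrable hc hg (T x)
  have j2 := hT.integrable hc hg (T y)
  have h1 : |langevinOp T γ f x - langevinOp T γ f y|
      ≤ ‖T x - T y‖ * ((langevinOp T γ g x + langevinOp T γ g y) / 2) := by
    unfold langevinOp
    rw [← integral_sub i1 i2, ← integral_add j1 j2, ← integral_div, ← integral_const_mul]
    refine norm_integral_le_of_norm_le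
      (f := fun w => f (T x + √(2 * γ) • w) - f (T y + √(2 * γ) • w)) (((j1.add j2).div_const 2).const_mul _)
      (.of_forall fun w => ?_)
    have := hfg (T x + √(2 * γ) • w) (T y + √(2 * γ) • w)
    rwa [add_sub_add_right_eq_sub] at this
  refine h1.trans ?_
  have h2 := langevinOp_nonneg (T := T) (γ := γ) hg0 x
  have h3 := langevinOp_nonneg (T := T) (γ := γ) hg0 y
  refine (mul_le_mul_of_nonneg_right (hT.norm_sub_le x y) (by positivity)).trans_eq ?_
  ring

/-- The local Poincaré inequality for one step of the chain. -/
theorem IsLangevinStep.local_poincare (hT : IsLangevinStep T κ γ) (hc0 : 0 ≤ c)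
    (hc : 16 * c ≤ κ * 2) (hcγ : 4 * c * γ < 1 / 4)
    (hf : HasGaussianGrowth c f) (hg : HasGaussianGrowth c g) (hg0 : ∀ x, 0 ≤ g x)
    (hfg : HasSlopeBound f g) (x : E) :
    langevinOp T γ (fun y => f y ^ 2) x - langevinOp T γ f x ^ 2
      ≤ 2 * γ * langevinOp T γ (fun y => g y ^ 2) x := by
  have hs : √(2 * γ) ^ 2 = 2 * γ := Real.sq_sqrt (by linarith [hT.step_pos])
  set s := √(2 * γ) with hsd
  have hs0 : 0 ≤ s := Real.sqrt_nonneg _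
  have hgc := hg.1
  have hfc := hf.1
  obtain ⟨C, hC⟩ := hg.2
  have hC0 : 0 ≤ C := by
    have := (abs_nonneg _).trans (hC 0)
    simpa using this
  have hΦ : HasSlopeBound (fun w => f (T x + s • w)) (fun w => s * g (T x + s • w)) := by
    intro u v
    refine (hfg _ _).trans_eq ?_
    rw [add_sub_add_left_eq_sub, ← smul_sub, norm_smul, Real.norm_eq_abs, abs_of_nonneg hs0]
    ring
  have hmem : MemLp (fun w => f (T x + s • w)) 2 (stdGaussian E) := by
    rw [memLp_two_iff_integrable_sq (by fun_prop)]
    exact hT.integrable (c := 2 * c) (by linarith) hf.sq _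
  -- As a function of w the exponent is at most 2c‖T x‖² + 2c·2γ‖w‖², hence the growth parameter
  -- 4cγ.
  have h := hΦ.poincare (by fun_prop) (fun w => mul_nonneg hs0 (hg0 _)) (c := 4 * c * γ)
    (C := s * (C * Real.exp (2 * c * ‖T x‖ ^ 2)))
    (mul_nonneg (by positivity) hT.step_pos.le) hcγ (fun w => by
      rw [mul_assoc, mul_assoc C, ← Real.exp_add]
      refine mul_le_mul_of_nonneg_left (((le_abs_self _).trans (hC _)).trans ?_) hs0
      gcongr
      have h1 := norm_add_sq_le_two_mul (T x) (s • w)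
      rw [norm_smul, mul_pow, Real.norm_eq_abs, sq_abs, hs] at h1
      nlinarith) hmem
  refine h.trans_eq ?_
  unfold langevinOp
  simp_rw [mul_pow, hs]
  rw [integral_const_mul]

theorem IsLangevinStep.sq_langevinOp_le (hT : IsLangevinStep T κ γ) (hc : 8 * c ≤ κ)
    (hf : HasGaussianGrowth c f) (hc0 : 0 ≤ c) (x : E) :
    langevinOp T γ f x ^ 2 ≤ langevinOp T γ (fun y => f y ^ 2) x := by
  have i1 := hT.integrable (by linarith) hf (T x)
  have i2 := hT.integrable (c := 2 * c) (by linarith) hf.sq (T x)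
  have h := variance_eq_sub (μ := stdGaussian E) (X := fun w => f (T x + √(2 * γ) • w))
    ((memLp_two_iff_integrable_sq i1.1).2 i2)
  have h0 := variance_nonneg (fun w => f (T x + √(2 * γ) • w)) (stdGaussian E)
  rw [h] at h0
  exact sub_nonneg.1 h0

theorem IsLangevinStep.integrable_exp_chainLaw (hT : IsLangevinStep T κ γ) (hc0 : 0 ≤ c)
    (hc : 4 * c ≤ κ) (k : ℕ) :
    Integrable (fun x => Real.exp (c * ‖x‖ ^ 2)) (chainLaw T γ k) := by
  have hTc := hT.continuous
  induction k with
  | zero => exact integrable_dirac (by simp)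
  | succ k ih =>
    have := hT.isProbabilityMeasure_chainLaw k
    rw [chainLaw, integrable_map_measure (by fun_prop) (by fun_prop), Function.comp_def,
      integrable_prod_iff (by fun_prop)]
    refine ⟨.of_forall fun x => hT.integrable_exp hc (T x), ?_⟩
    refine (ih.const_mul ((1 - 4 * c * γ) ^ (-(finrank ℝ E / 2 : ℝ)))).mono' ?_
      (.of_forall fun x => ?_)
    · have : Continuous fun p : E × E => ‖Real.exp (c * ‖T p.1 + √(2 * γ) • p.2‖ ^ 2)‖ := by
        fun_prop
      exact (this.stronglyMeasurable.integral_prod_right).aestronglyMeasurable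
    · simp only [Real.norm_eq_abs, Real.abs_exp]
      rw [hT.integral_exp hc]
      have hD : 0 < 1 - 4 * c * γ := by linarith [hT.lt_one_of_le hc]
      rw [abs_of_nonneg (by positivity)]
      exact mul_le_mul_of_nonneg_left (hT.exp_le hc0 hc x) (by positivity)

theorem IsLangevinStep.integrable_chainLaw (hT : IsLangevinStep T κ γ) (hc0 : 0 ≤ c)
    (hc : 4 * c ≤ κ) (hf : HasGaussianGrowth c f) (k : ℕ) : Integrable f (chainLaw T γ k) := by
  obtain ⟨hfc, C, hC⟩ := hf
  exact ((hT.integrable_exp_chainLaw hc0 hc k).const_mul C).mono' (by fun_prop)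
    (.of_forall hC)

theorem IsLangevinStep.integral_chainLaw_succ (hT : IsLangevinStep T κ γ) (hc0 : 0 ≤ c)
    (hc : 4 * c ≤ κ) (hf : HasGaussianGrowth c f) (k : ℕ) :
    ∫ x, f x ∂(chainLaw T γ (k + 1)) = ∫ x, langevinOp T γ f x ∂(chainLaw T γ k) := by
  have hTc := hT.continuous
  have hfc := hf.1
  have := hT.isProbabilityMeasure_chainLaw k
  have hi := hT.integrable_chainLaw hc0 hc hf (k + 1)
  rw [chainLaw, integrable_map_measure (by fun_prop) (by fun_prop)] at hi
  rw [chainLaw, integral_map (by fun_prop) (by fun_prop)]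
  exact integral_prod _ hi

end Kernel


/-! ### Uniform exponential moments along the chain -/

section Moments

open Filter Topology Module

/-- Convexity in the exponent bounds its derivative by a right difference quotient. Only an upper
bound on the moment is needed, so no differentiation under the integral occurs. -/
theorem mul_exp_le_sub_div {t c δ : ℝ} (hδ : 0 < δ) :
    t * Real.exp (c * t) ≤ (Real.exp ((c + δ) * t) - Real.exp (c * t)) / δ := by
  have h : δ * t ≤ Real.exp (δ * t) - 1 := by linarith [Real.add_one_le_exp (δ * t)]
  rw [le_div_iff₀ hδ, add_mul, Real.exp_add]
  nlinarith [Real.exp_pos (c * t)]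

theorem hasDerivAt_gaussian_exp_moment {n B σ c : ℝ} (h : 2 * c * σ < 1) :
    HasDerivAt (fun c => (1 - 2 * c * σ) ^ (-(n / 2)) * Real.exp (c * B / (1 - 2 * c * σ)))
      ((1 - 2 * c * σ) ^ (-(n / 2)) * Real.exp (c * B / (1 - 2 * c * σ)) *
        (n * σ / (1 - 2 * c * σ) + B / (1 - 2 * c * σ) ^ 2)) c := by
  have hD : 0 < 1 - 2 * c * σ := by linarith
  have h1 : HasDerivAt (fun c : ℝ => 1 - 2 * c * σ) (-(2 * σ)) c := by
    have := (((hasDerivAt_id c).const_mul 2).mul_const σ).const_sub 1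
    simpa using this
  have h2 := h1.rpow_const (p := -(n / 2)) (.inl hD.ne')
  have h3 : HasDerivAt (fun c : ℝ => c * B) B c := by
    simpa using (hasDerivAt_id c).mul_const B
  have h4 := (h3.div h1 hD.ne').exp
  refine (h2.mul h4).congr_deriv ?_
  have e : (1 - 2 * c * σ) ^ (-(n / 2) - 1) = (1 - 2 * c * σ) ^ (-(n / 2)) / (1 - 2 * c * σ) := by
    rw [Real.rpow_sub_one hD.ne']
  rw [e]
  simp only [Pi.div_apply]
  generalize (1 - 2 * c * σ) ^ (-(n / 2)) = R
  generalize Real.exp _ = X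
  obtain ⟨D, hDd⟩ : ∃ D, D = 1 - 2 * c * σ := ⟨_, rfl⟩
  have hcs : B * D - c * B * (-(2 * σ)) = B := by rw [hDd]; ring
  rw [← hDd] at hD ⊢
  rw [hcs]
  field_simp

variable {E : Type*} [NormedAddCommGroup E] [InnerProductSpace ℝ E] [FiniteDimensional ℝ E]
  [MeasurableSpace E] [BorelSpace E]

variable {T : E → E} {κ γ c : ℝ} {f g : E → ℝ}

omit [InnerProductSpace ℝ E] [FiniteDimensional ℝ E] [MeasurableSpace E] [BorelSpace E] in
theorem hasGaussianGrowth_quadratic {c c' α β : ℝ} (hcc : c < c')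
    (hα : 0 ≤ α) (hβ : 0 ≤ β) :
    HasGaussianGrowth c' (fun x : E => (α + β * ‖x‖ ^ 2) * Real.exp (c * ‖x‖ ^ 2)) := by
  refine ⟨by fun_prop, α + β / (c' - c), fun x => ?_⟩
  have hd : 0 < c' - c := by linarith
  rw [abs_of_nonneg (by positivity)]
  simp only [add_mul]
  refine add_le_add (by gcongr) ?_
  rw [mul_assoc, div_mul_eq_mul_div, mul_div_assoc]
  refine mul_le_mul_of_nonneg_left ?_ hβ
  refine (mul_exp_le_sub_div hd).trans ?_
  rw [add_sub_cancel]
  gcongr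
  linarith [Real.exp_pos (c * ‖x‖ ^ 2)]

theorem integral_sq_norm_mul_exp_le (hT : IsLangevinStep T κ γ) (hc : 4 * c < κ)
    (b : E) :
    ∫ w, ‖b + √(2 * γ) • w‖ ^ 2 * Real.exp (c * ‖b + √(2 * γ) • w‖ ^ 2) ∂(stdGaussian E)
      ≤ (1 - 4 * c * γ) ^ (-(finrank ℝ E / 2 : ℝ)) * Real.exp (c * ‖b‖ ^ 2 / (1 - 4 * c * γ)) *
        (finrank ℝ E * (2 * γ) / (1 - 4 * c * γ) + ‖b‖ ^ 2 / (1 - 4 * c * γ) ^ 2) := by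
  have e : ∀ c : ℝ, 2 * c * (2 * γ) = 4 * c * γ := fun c => by ring
  have hd := hasDerivAt_gaussian_exp_moment (n := finrank ℝ E) (B := ‖b‖ ^ 2) (σ := 2 * γ) (c := c)
    (by rw [e]; exact hT.lt_one_of_le hc.le)
  simp_rw [e] at hd
  refine ge_of_tendsto hd.tendsto_slope_zero_right ?_
  have hev : ∀ᶠ δ in 𝓝[>] (0 : ℝ), 0 < δ ∧ 4 * (c + δ) ≤ κ := by
    have h1 : ∀ᶠ δ in 𝓝[>] (0 : ℝ), δ < (κ - 4 * c) / 4 :=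
      nhdsWithin_le_nhds (eventually_lt_nhds (by linarith))
    filter_upwards [self_mem_nhdsWithin, h1] with δ h0 h2
    exact ⟨h0, by linarith⟩
  filter_upwards [hev] with δ ⟨hδ, hδc⟩
  have i1 := hT.integrable_exp hδc b
  have i2 := hT.integrable_exp hc.le b
  have i3 : Integrable (fun w => ‖b + √(2 * γ) • w‖ ^ 2 *
      Real.exp (c * ‖b + √(2 * γ) • w‖ ^ 2)) (stdGaussian E) := by
    have := hT.integrable hδc (hasGaussianGrowth_quadratic (E := E) (c := c) (c' := c + δ)
      (α := 0) (β := 1) (by linarith) le_rfl zero_le_one) b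
    simpa using this
  have h := integral_mono i3 ((i1.sub i2).div_const δ) fun w =>
    mul_exp_le_sub_div (c := c) (t := ‖b + √(2 * γ) • w‖ ^ 2) hδ
  simp only [Pi.sub_apply] at h
  rw [integral_div, integral_sub i1 i2, hT.integral_exp hδc, hT.integral_exp hc.le] at h
  rw [smul_eq_mul, inv_mul_eq_div]
  exact h

theorem langevinOp_quadratic_le (hT : IsLangevinStep T κ γ) (hc0 : 0 ≤ c) (hc : 4 * c < κ)
    {α β : ℝ} (hα : 0 ≤ α) (hβ : 0 ≤ β) (x : E) :
    langevinOp T γ (fun x => (α + β * ‖x‖ ^ 2) * Real.exp (c * ‖x‖ ^ 2)) x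
      ≤ (1 - 4 * c * γ) ^ (-(finrank ℝ E / 2 : ℝ)) *
        ((α + 2 * γ * finrank ℝ E * β / (1 - 4 * c * γ)
          + β * (1 - κ * γ) / (1 - 4 * c * γ) ^ 2 * ‖x‖ ^ 2)
          * Real.exp (c * (1 - κ * γ) / (1 - 4 * c * γ) * ‖x‖ ^ 2)) := by
  have hD : 0 < 1 - 4 * c * γ := by linarith [hT.lt_one_of_le hc.le]
  have hγ := hT.step_pos
  have i2 := hT.integrable_exp hc.le (T x)
  have i3 : Integrable (fun w => ‖T x + √(2 * γ) • w‖ ^ 2 *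
      Real.exp (c * ‖T x + √(2 * γ) • w‖ ^ 2)) (stdGaussian E) := by
    have := hT.integrable (by linarith) (hasGaussianGrowth_quadratic (E := E) (c := c)
      (c' := κ / 4) (α := 0) (β := 1) (by linarith) le_rfl zero_le_one) (T x)
    simpa using this
  have e : langevinOp T γ (fun x => (α + β * ‖x‖ ^ 2) * Real.exp (c * ‖x‖ ^ 2)) x
      = α * ∫ w, Real.exp (c * ‖T x + √(2 * γ) • w‖ ^ 2) ∂(stdGaussian E)
        + β * ∫ w, ‖T x + √(2 * γ) • w‖ ^ 2 * Real.exp (c * ‖T x + √(2 * γ) • w‖ ^ 2)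
          ∂(stdGaussian E) := by
    rw [← integral_const_mul, ← integral_const_mul, ← integral_add (i2.const_mul _)
      (i3.const_mul _)]
    unfold langevinOp
    refine integral_congr_ae (.of_forall fun w => ?_)
    simp only
    ring
  rw [e, hT.integral_exp hc.le]
  have h1 := mul_le_mul_of_nonneg_left (integral_sq_norm_mul_exp_le hT hc (T x)) hβ
  refine (add_le_add_right h1 _).trans ?_
  set R := (1 - 4 * c * γ) ^ (-(finrank ℝ E / 2 : ℝ)) with hR
  set D := 1 - 4 * c * γ with hDd
  have hR0 : 0 ≤ R := by positivity
  have hTx := hT.norm_sq_le x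
  have hexp : Real.exp (c * ‖T x‖ ^ 2 / D) ≤ Real.exp (c * (1 - κ * γ) / D * ‖x‖ ^ 2) := by
    refine Real.exp_le_exp.2 ?_
    rw [div_mul_eq_mul_div, mul_assoc]
    gcongr
  calc _ = R * ((α + 2 * γ * finrank ℝ E * β / D + β / D ^ 2 * ‖T x‖ ^ 2) *
        Real.exp (c * ‖T x‖ ^ 2 / D)) := by field_simp; ring
    _ ≤ _ := by
        refine mul_le_mul_of_nonneg_left ?_ hR0
        refine mul_le_mul ?_ hexp (Real.exp_nonneg _) ?_
        · have : β / D ^ 2 * ‖T x‖ ^ 2 ≤ β / D ^ 2 * ((1 - κ * γ) * ‖x‖ ^ 2) := by gcongr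
          have e2 : β / D ^ 2 * ((1 - κ * γ) * ‖x‖ ^ 2) = β * (1 - κ * γ) / D ^ 2 * ‖x‖ ^ 2 := by
            ring
          linarith
        · have := hT.mul_lt_one
          have : 0 ≤ 1 - κ * γ := by linarith
          positivity

theorem rpow_neg_le_exp {D y : ℝ} (hD : 0 < D) (hy : 0 ≤ y) :
    D ^ (-y) ≤ Real.exp (y * ((1 - D) / D)) := by
  rw [Real.rpow_def_of_pos hD]
  refine Real.exp_le_exp.2 ?_
  have h := Real.one_sub_inv_le_log_of_pos hD
  have e : (1 - D) / D = D⁻¹ - 1 := by field_simp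
  rw [e]
  nlinarith

/-- Moment bound along the chain. -/
theorem IsLangevinStep.moment_le (hT : IsLangevinStep T κ γ) {A : ℝ} (hA : 4 * A < κ) (k : ℕ) :
    ∀ {c α β : ℝ}, 0 ≤ c → c ≤ A → 0 ≤ α → 0 ≤ β →
    ∫ x, (α + β * ‖x‖ ^ 2) * Real.exp (c * ‖x‖ ^ 2) ∂(chainLaw T γ k)
      ≤ (α + β * (2 * finrank ℝ E * ((1 - 4 * A * γ) / (κ - 4 * A))))
        * Real.exp (2 * c * (finrank ℝ E + 2) / (κ - 4 * A)) := by
  have hγ := hT.step_pos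
  have hκγ := hT.mul_lt_one
  set n : ℝ := ((finrank ℝ E : ℕ) : ℝ) with hn
  have hn0 : 0 ≤ n := by positivity
  set ξ := κ - 4 * A with hξ
  have hξ0 : 0 < ξ := by linarith
  have hDA : 0 < 1 - 4 * A * γ := by linarith [hT.lt_one_of_le hA.le]
  set C1 := 2 * n * ((1 - 4 * A * γ) / ξ) with hC1
  have hC10 : 0 ≤ C1 := by positivity
  -- The parameters c, α, β change at every step, so the induction hypothesis covers all of them;
  -- only A stays fixed.
  induction k with
  | zero =>
    intro c α β hc0 hcA hα hβ
    rw [chainLaw, integral_dirac]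
    simp only [norm_zero, ne_eq, OfNat.ofNat_ne_zero, not_false_eq_true, zero_pow, mul_zero,
      add_zero, Real.exp_zero, mul_one]
    have h1 : 1 ≤ Real.exp (2 * c * (n + 2) / ξ) := Real.one_le_exp (by positivity)
    have h2 : α ≤ α + β * C1 := le_add_of_nonneg_right (by positivity)
    calc α ≤ α + β * C1 := h2
      _ ≤ _ := le_mul_of_one_le_right (by positivity) h1
  | succ k ih =>
    intro c α β hc0 hcA hα hβ
    have hc : 4 * c < κ := by linarith
    have hD : 0 < 1 - 4 * c * γ := by linarith [hT.lt_one_of_le hc.le]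
    have hg : HasGaussianGrowth (κ / 4)
        (fun x : E => (α + β * ‖x‖ ^ 2) * Real.exp (c * ‖x‖ ^ 2)) :=
      hasGaussianGrowth_quadratic (by linarith) hα hβ
    have hκ := hT.kappa_pos
    have hκγ0 : 0 ≤ 1 - κ * γ := by linarith
    rw [hT.integral_chainLaw_succ (by positivity) (by linarith) hg]
    set D := 1 - 4 * c * γ with hDd
    set c' := c * (1 - κ * γ) / D with hc'
    have hc'0 : 0 ≤ c' := by positivity
    have hrD : 1 - κ * γ ≤ D := by rw [hDd]; nlinarith
    have hc'c : c' ≤ c := by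
      rw [hc', div_le_iff₀ hD]
      exact mul_le_mul_of_nonneg_left hrD hc0
    set α' := α + 2 * γ * n * β / D with hα'
    set β' := β * (1 - κ * γ) / D ^ 2 with hβ'
    have hα'0 : 0 ≤ α' := by positivity
    have hβ'0 : 0 ≤ β' := by positivity
    have hg' : HasGaussianGrowth (κ / 4)
        (fun x : E => (α' + β' * ‖x‖ ^ 2) * Real.exp (c' * ‖x‖ ^ 2)) :=
      hasGaussianGrowth_quadratic (by linarith) hα'0 hβ'0
    have hi' := (hT.integrable_chainLaw (by positivity) (by linarith) hg' k).const_mul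
      (D ^ (-(n / 2)))
    have hle : ∫ x, langevinOp T γ (fun x => (α + β * ‖x‖ ^ 2) * Real.exp (c * ‖x‖ ^ 2)) x
        ∂(chainLaw T γ k) ≤ D ^ (-(n / 2)) * ((α' + β' * C1) *
          Real.exp (2 * c' * (n + 2) / ξ)) := by
      refine (integral_mono_of_nonneg (.of_forall fun x => langevinOp_nonneg
        (fun y => by positivity) x) hi' (.of_forall fun x =>
          langevinOp_quadratic_le hT hc0 hc hα hβ x)).trans ?_
      rw [integral_const_mul]
      exact mul_le_mul_of_nonneg_left (ih hc'0 (hc'c.trans hcA) hα'0 hβ'0) (by positivity)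
    refine hle.trans ?_
    have hbr : α' + β' * C1 ≤ D⁻¹ * (α + β * C1) := by
      have hD1 : D ≤ 1 := by rw [hDd]; nlinarith [mul_nonneg hc0 hγ.le]
      have hDinv : 1 ≤ D⁻¹ := (one_le_inv₀ hD).2 hD1
      -- C1 is the fixed point of C ↦ 2γn + (1 - κγ) C / (1 - 4Aγ), and c ≤ A makes the actual
      -- factor no larger.
      have key : 2 * γ * n + (1 - κ * γ) * C1 / D ≤ C1 := by
        have h1 : (1 - κ * γ) * C1 / D ≤ (1 - κ * γ) * C1 / (1 - 4 * A * γ) := by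
          have : 1 - 4 * A * γ ≤ D := by rw [hDd]; nlinarith
          gcongr
        have h2 : 2 * γ * n + (1 - κ * γ) * C1 / (1 - 4 * A * γ) = C1 := by
          have h3 : 1 - κ * γ = (1 - 4 * A * γ) - γ * ξ := by rw [hξ]; ring
          rw [hC1, h3]
          generalize 1 - 4 * A * γ = q at hDA
          field_simp
          ring
        linarith
      have h3 : α ≤ D⁻¹ * α := le_mul_of_one_le_left hα hDinv
      have h4 : α' + β' * C1 = α + D⁻¹ * β * (2 * γ * n + (1 - κ * γ) * C1 / D) := by
        rw [hα', hβ']; field_simp; ring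
      have h5 : D⁻¹ * β * (2 * γ * n + (1 - κ * γ) * C1 / D) ≤ D⁻¹ * β * C1 :=
        mul_le_mul_of_nonneg_left key (by positivity)
      rw [h4, mul_add]
      linarith
    -- The inverse power of D from the quadratic part joins the Gaussian normalisation, turning n/2
    -- into n/2 + 1; hence the n + 2 in the exponent.
    have hpow : D ^ (-(n / 2)) * D⁻¹ ≤ Real.exp (2 * c * γ * (n + 2) / D) := by
      have h1 := rpow_neg_le_exp (y := n / 2 + 1) hD (by positivity)
      have h2 : D ^ (-(n / 2)) * D⁻¹ = D ^ (-(n / 2 + 1)) := by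
        rw [← Real.rpow_neg_one D, ← Real.rpow_add hD]; ring_nf
      rw [h2]
      refine h1.trans_eq ?_
      congr 1
      rw [hDd]
      ring
    -- Telescoping: the decrease c - c' is at least cγξ/D, enough to pay for the prefactor of this
    -- step.
    have hexp : 2 * c * γ * (n + 2) / D + 2 * c' * (n + 2) / ξ ≤ 2 * c * (n + 2) / ξ := by
      have h1 : c - c' = c * γ * (κ - 4 * c) / D := by
        rw [hc', eq_div_iff hD.ne', sub_mul, div_mul_cancel₀ _ hD.ne', hDd]; ring
      have h2 : c * γ * ξ / D ≤ c - c' := by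
        rw [h1]
        have : ξ ≤ κ - 4 * c := by linarith
        gcongr
      have h3 : 2 * c * γ * (n + 2) / D = 2 * (n + 2) / ξ * (c * γ * ξ / D) := by
        field_simp
      have h4 := mul_le_mul_of_nonneg_left h2 (a := 2 * (n + 2) / ξ) (by positivity)
      rw [h3]
      have h5 : 2 * (n + 2) / ξ * (c - c') = 2 * c * (n + 2) / ξ - 2 * c' * (n + 2) / ξ := by
        ring
      linarith
    calc D ^ (-(n / 2)) * ((α' + β' * C1) * Real.exp (2 * c' * (n + 2) / ξ))
        ≤ D ^ (-(n / 2)) * ((D⁻¹ * (α + β * C1)) * Real.exp (2 * c' * (n + 2) / ξ)) := by gcongr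
      _ = (α + β * C1) * ((D ^ (-(n / 2)) * D⁻¹) * Real.exp (2 * c' * (n + 2) / ξ)) := by ring
      _ ≤ (α + β * C1) * (Real.exp (2 * c * γ * (n + 2) / D)
            * Real.exp (2 * c' * (n + 2) / ξ)) := by gcongr
      _ ≤ _ := by
        rw [← Real.exp_add]
        gcongr

end Moments


/-! ### Convexity, cocoercivity and contraction of the drift -/

section Potential

open RealInnerProductSpace

variable {E : Type*} [NormedAddCommGroup E] [InnerProductSpace ℝ E]

/-- A convex function with a quadratic upper bound has a cocoercive gradient. -/
theorem norm_sub_sq_le_of_convex_of_smooth {φ : E → ℝ} {g : E → E} {K : ℝ} (hK : 0 < K)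
    (hlow : ∀ x z, φ x + ⟪g x, z - x⟫ ≤ φ z)
    (hup : ∀ y z, φ z ≤ φ y + ⟪g y, z - y⟫ + K / 2 * ‖z - y‖ ^ 2) (x y : E) :
    ‖g x - g y‖ ^ 2 ≤ K * ⟪g x - g y, x - y⟫ := by
  have key : ∀ x y, φ x + ⟪g x, y - x⟫ + 1 / (2 * K) * ‖g x - g y‖ ^ 2 ≤ φ y := by
    intro x y
    -- The test point is the gradient step of length 1/K from y for φ - ⟪g x, ·⟫; it minimises the
    -- quadratic upper bound.
    have h1 := (hlow x (y - K⁻¹ • (g y - g x))).trans (hup y (y - K⁻¹ • (g y - g x)))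
    have e1 : y - K⁻¹ • (g y - g x) - x = (y - x) - K⁻¹ • (g y - g x) := by abel
    have e2 : y - K⁻¹ • (g y - g x) - y = -(K⁻¹ • (g y - g x)) := by abel
    rw [e1, e2, inner_sub_right, inner_neg_right, inner_smul_right, inner_smul_right, norm_neg,
      norm_smul, mul_pow, Real.norm_eq_abs, sq_abs] at h1
    have e3 : ⟪g y, g y - g x⟫ - ⟪g x, g y - g x⟫ = ‖g y - g x‖ ^ 2 := by
      rw [← inner_sub_left, real_inner_self_eq_norm_sq]
    have e4 : K / 2 * (K⁻¹ ^ 2 * ‖g y - g x‖ ^ 2) = 1 / (2 * K) * ‖g y - g x‖ ^ 2 := by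
      field_simp
    have e5 : K⁻¹ * (⟪g y, g y - g x⟫ - ⟪g x, g y - g x⟫) = 2 * (1 / (2 * K) * ‖g y - g x‖ ^ 2) := by
      rw [e3]; field_simp
    rw [norm_sub_rev (g x)]
    linarith
  have h1 := key x y
  have h2 := key y x
  rw [norm_sub_rev (g y)] at h2
  have e1 : ⟪g x - g y, x - y⟫ = -⟪g x, y - x⟫ - ⟪g y, x - y⟫ := by
    rw [inner_sub_left, ← neg_sub x y, inner_neg_right, neg_neg]
  have h3 : 2 * (1 / (2 * K) * ‖g x - g y‖ ^ 2) ≤ ⟪g x - g y, x - y⟫ := by rw [e1]; linarith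
  have h4 : 2 * (1 / (2 * K) * ‖g x - g y‖ ^ 2) = ‖g x - g y‖ ^ 2 / K := by field_simp
  rw [h4, div_le_iff₀ hK] at h3
  linarith

/-- The descent lemma. -/
theorem le_add_of_gradient_lipschitz [CompleteSpace E] {U : E → ℝ} (hU : Differentiable ℝ U)
    {L : ℝ} (hL : ∀ x y, ‖gradient U x - gradient U y‖ ≤ L * ‖x - y‖) (x y : E) :
    U y ≤ U x + ⟪gradient U x, y - x⟫ + L / 2 * ‖y - x‖ ^ 2 := by
  set v := y - x with hv
  have hd : ∀ t : ℝ, HasDerivAt (fun t : ℝ => U (x + t • v) - t * ⟪gradient U x, v⟫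
      - L / 2 * ‖v‖ ^ 2 * t ^ 2)
      (⟪gradient U (x + t • v), v⟫ - ⟪gradient U x, v⟫ - L / 2 * ‖v‖ ^ 2 * (2 * t)) t := by
    intro t
    have h1 : HasDerivAt (fun t : ℝ => x + t • v) v t := by
      simpa using ((hasDerivAt_id t).smul_const v).const_add x
    have h2 := ((hU (x + t • v)).hasGradientAt.hasFDerivAt).comp_hasDerivAt t h1
    have h3 : HasDerivAt (fun t : ℝ => t * ⟪gradient U x, v⟫) ⟪gradient U x, v⟫ t := by
      simpa using (hasDerivAt_id t).mul_const ⟪gradient U x, v⟫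
    have h4 : HasDerivAt (fun t : ℝ => L / 2 * ‖v‖ ^ 2 * t ^ 2) (L / 2 * ‖v‖ ^ 2 * (2 * t)) t := by
      simpa using (hasDerivAt_pow 2 t).const_mul (L / 2 * ‖v‖ ^ 2)
    refine ((h2.sub h3).sub h4).congr_deriv ?_
    simp
  have hanti : AntitoneOn (fun t : ℝ => U (x + t • v) - t * ⟪gradient U x, v⟫
      - L / 2 * ‖v‖ ^ 2 * t ^ 2) (Set.Icc 0 1) := by
    refine antitoneOn_of_deriv_nonpos (convex_Icc 0 1)
      (fun t _ => (hd t).continuousAt.continuousWithinAt)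
      (fun t _ => (hd t).differentiableAt.differentiableWithinAt) fun t ht => ?_
    rw [interior_Icc] at ht
    rw [(hd t).deriv, ← inner_sub_left]
    have h1 := real_inner_le_norm (gradient U (x + t • v) - gradient U x) v
    have h2 := hL (x + t • v) x
    rw [add_sub_cancel_left, norm_smul, Real.norm_eq_abs, abs_of_pos ht.1] at h2
    have h3 := mul_le_mul_of_nonneg_right h2 (norm_nonneg v)
    nlinarith
  have h := hanti (Set.left_mem_Icc.2 zero_le_one) (Set.right_mem_Icc.2 zero_le_one) zero_le_one
  simp only [one_smul, zero_smul, add_zero, one_mul, zero_mul, one_pow, mul_one, ne_eq,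
    OfNat.ofNat_ne_zero, not_false_eq_true, zero_pow, mul_zero, sub_zero] at h
  rw [hv, add_sub_cancel, ← hv] at h
  linarith

variable {d : ℕ} {U : EuclideanSpace ℝ (Fin d) → ℝ} {L m : ℝ}

theorem GradientLipschitz.differentiable (hU : GradientLipschitz L U) : Differentiable ℝ U :=
  hU.1.differentiable one_ne_zero

/-- The lower and upper quadratic bounds are compared at a nonzero vector, which exists because d ≥
1. -/
theorem le_of_gradientConvex_of_gradientLipschitz (hd : 1 ≤ d) (hUL : GradientLipschitz L U)
    (hUm : GradientConvex m U) : m ≤ L := by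
  have : Nonempty (Fin d) := ⟨⟨0, hd⟩⟩
  obtain ⟨v, hv⟩ := exists_ne (0 : EuclideanSpace ℝ (Fin d))
  have h1 := hUm.2 0 v
  have h2 := le_add_of_gradient_lipschitz hUL.differentiable hUL.2.2 0 v
  have hv0 : 0 < ‖v‖ ^ 2 := by positivity
  rw [zero_sub, norm_neg] at h1
  rw [sub_zero] at h2 h1
  nlinarith

theorem gradient_cocoercive (hmL : m ≤ L) (hUL : GradientLipschitz L U)
    (hUm : GradientConvex m U) (x y : EuclideanSpace ℝ (Fin d)) :
    ‖gradient U x - gradient U y - m • (x - y)‖ ^ 2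
      ≤ (L - m) * ⟪gradient U x - gradient U y - m • (x - y), x - y⟫ := by
  have hup := le_add_of_gradient_lipschitz hUL.differentiable hUL.2.2
  have e : ∀ x z : EuclideanSpace ℝ (Fin d), ‖z - x‖ ^ 2 = ‖z‖ ^ 2 - ‖x‖ ^ 2 - 2 * ⟪x, z - x⟫ := by
    intro x z
    rw [norm_sub_sq_real, inner_sub_right, real_inner_self_eq_norm_sq, real_inner_comm]
    ring
  -- Cocoercivity for U - (m/2)‖·‖², which is convex and smooth with constant L - m. The case L = m
  -- is allowed, so the constant is enlarged by δ, which then tends to 0.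
  have hK : ∀ δ > 0, ‖gradient U x - gradient U y - m • (x - y)‖ ^ 2
      ≤ (L - m + δ) * ⟪gradient U x - gradient U y - m • (x - y), x - y⟫ := by
    intro δ hδ
    have h := norm_sub_sq_le_of_convex_of_smooth (φ := fun z => U z - m / 2 * ‖z‖ ^ 2)
      (g := fun z => gradient U z - m • z) (K := L - m + δ) (by linarith) (fun x z => by
        have h1 := hUm.2 x z
        rw [norm_sub_rev, e x z] at h1
        rw [inner_sub_left, real_inner_smul_left]
        linarith) (fun y z => by
        have h1 := hup y z
        have h2 : 0 ≤ δ / 2 * ‖z - y‖ ^ 2 := by positivity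
        have h3 : m / 2 * ‖z - y‖ ^ 2 = m / 2 * (‖z‖ ^ 2 - ‖y‖ ^ 2 - 2 * ⟪y, z - y⟫) := by
          rw [e y z]
        rw [inner_sub_left, real_inner_smul_left]
        linarith) x y
    have e2 : gradient U x - m • x - (gradient U y - m • y)
        = gradient U x - gradient U y - m • (x - y) := by module
    rwa [e2] at h
  have hlim : Filter.Tendsto (fun δ : ℝ => (L - m + δ) *
      ⟪gradient U x - gradient U y - m • (x - y), x - y⟫) (nhdsWithin 0 (Set.Ioi 0))
      (nhds ((L - m + 0) * ⟪gradient U x - gradient U y - m • (x - y), x - y⟫)) :=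
    (Continuous.tendsto (by fun_prop) 0).mono_left nhdsWithin_le_nhds
  rw [add_zero] at hlim
  exact ge_of_tendsto hlim (Filter.eventually_of_mem self_mem_nhdsWithin hK)

theorem gradient_potential (hU : Differentiable ℝ U) (s : ℝ≥0∞) (x : EuclideanSpace ℝ (Fin d)) :
    gradient (potential U s) x = precision s • x + gradient U x := by
  refine HasGradientAt.gradient ?_
  have h1 := (hasStrictFDerivAt_norm_sq x).hasFDerivAt.const_mul (precision s / 2)
  have h2 := (h1.add (hU x).hasGradientAt.hasFDerivAt).congr_of_eventuallyEq
    (f₁ := potential U s) (.of_forall fun y => by simp [potential]; ring)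
  rw [hasGradientAt_iff_hasFDerivAt]
  convert! h2 using 1
  ext v
  simp
  ring

theorem precision_nonneg (s : ℝ≥0∞) : 0 ≤ precision s := ENNReal.toReal_nonneg

/-- κ is the harmonic mean of m_i ≤ L_i. -/
theorem kappa_ge (hm : 0 ≤ m) (hmL : m ≤ L) {s : ℝ≥0∞} (hs : 0 < precision s) :
    convConst m s ≤ kappa m L s := by
  have h1 : 0 < convConst m s := by unfold convConst; linarith
  have h2 : convConst m s ≤ lipConst L s := by unfold convConst lipConst; linarith
  rw [kappa, le_div_iff₀ (by linarith)]
  nlinarith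

/-- The step bound is 1/(m_i + L_i), and 4 m_i L_i ≤ (m_i + L_i)². -/
theorem kappa_mul_le {γ : ℝ} (hm : 0 ≤ m) (hmL : m ≤ L) {s : ℝ≥0∞} (hs : 0 < precision s)
    (hγ : StepCondition m L s γ) : kappa m L s * γ ≤ 1 / 2 := by
  have h1 : 0 < convConst m s := by unfold convConst; linarith
  have h2 : convConst m s ≤ lipConst L s := by unfold convConst lipConst; linarith
  have h3 : m + L + 2 * precision s = convConst m s + lipConst L s := by
    unfold convConst lipConst; ring
  have h4 := hγ.2
  rw [h3] at h4
  have h5 : 0 < kappa m L s := h1.trans_le (kappa_ge hm hmL hs)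
  refine (mul_le_mul_of_nonneg_left h4 h5.le).trans ?_
  have h6 : 0 < lipConst L s := h1.trans_le h2
  rw [kappa, mul_one_div, div_div, div_le_div_iff₀ (by positivity) two_pos]
  nlinarith [sq_nonneg (convConst m s - lipConst L s)]

theorem isLangevinStep_gradient {γ : ℝ} (hm : 0 ≤ m) (hmL : m ≤ L)
    (hUL : GradientLipschitz L U) (hUm : GradientConvex m U) (hU0 : ∀ x, U 0 ≤ U x)
    {s : ℝ≥0∞} (hs : 0 < precision s) (hγ : StepCondition m L s γ) :
    IsLangevinStep (fun x => x - γ • gradient (potential U s) x) (kappa m L s) γ := by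
  have h1 : 0 < convConst m s := by unfold convConst; linarith
  refine ⟨h1.trans_le (kappa_ge hm hmL hs), hγ.1, ?_, ?_, fun x y => ?_⟩
  · linarith [kappa_mul_le hm hmL hs hγ]
  · have : gradient U 0 = 0 := by
      have h : IsLocalMin U 0 := Filter.Eventually.of_forall hU0
      rw [gradient, h.fderiv_eq_zero, map_zero]
    simp [gradient_potential hUL.differentiable, this]
  · set p := precision s with hp
    simp only [gradient_potential hUL.differentiable]
    set G := gradient U x - gradient U y with hG
    set v := x - y with hv
    have hco := gradient_cocoercive hmL hUL hUm x y
    rw [← hG, ← hv] at hco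
    have e : x - γ • (p • x + gradient U x) - (y - γ • (p • y + gradient U y))
        = v - γ • (G + p • v) := by rw [hv, hG]; module
    rw [← hp, e]
    have hm1 : convConst m s = m + p := rfl
    have hL1 : lipConst L s = L + p := rfl
    set m' := convConst m s
    set L' := lipConst L s
    set H := G + p • v with hH
    have eG : G - m • v = H - m' • v := by rw [hH, hm1]; module
    have eL : L - m = L' - m' := by rw [hL1, hm1]; ring
    rw [eG, eL, norm_sub_sq_real, inner_sub_left, inner_smul_right, real_inner_smul_left,
      norm_smul, mul_pow, Real.norm_eq_abs, sq_abs, real_inner_self_eq_norm_sq] at hco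
    rw [norm_sub_sq_real, inner_smul_right, norm_smul, mul_pow, Real.norm_eq_abs, sq_abs,
      real_inner_comm]
    have hS : 0 < m' + L' := by linarith
    have hγ2 : γ * (m' + L') ≤ 1 := by
      have h4 := hγ.2
      have h3 : m + L + 2 * precision s = m' + L' := by rw [hm1, hL1]; ring
      rwa [h3, le_div_iff₀ hS] at h4
    -- Cocoercivity after expanding the square. Its ‖v‖² term yields κ; its ‖H‖² term absorbs γ²‖H‖²
    -- because γ(m' + L') ≤ 1.
    have hco2 : (‖H‖ ^ 2 + m' * L' * ‖v‖ ^ 2) / (m' + L') ≤ ⟪H, v⟫ := by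
      rw [div_le_iff₀ hS]; linarith
    have hk : kappa m L s = 2 * m' * L' / (m' + L') := rfl
    have h5 : (1 - kappa m L s * γ) * ‖v‖ ^ 2
        = ‖v‖ ^ 2 - 2 * γ * ((‖H‖ ^ 2 + m' * L' * ‖v‖ ^ 2) / (m' + L'))
          + 2 * γ * ‖H‖ ^ 2 / (m' + L') := by
      rw [hk]; field_simp; ring
    have h6 : γ ^ 2 * ‖H‖ ^ 2 ≤ 2 * γ * ‖H‖ ^ 2 / (m' + L') := by
      rw [le_div_iff₀ hS]
      have := hγ.1
      have h7 : 0 ≤ γ * ‖H‖ ^ 2 := by positivity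
      nlinarith
    have h8 := mul_le_mul_of_nonneg_left hco2 (a := 2 * γ) (by linarith [hγ.1])
    rw [h5]
    linarith

end Potential


/-! ### Martingale decomposition and variance of weighted sums -/

section Chain

variable {E : Type*} [NormedAddCommGroup E] [InnerProductSpace ℝ E] [FiniteDimensional ℝ E]
  [MeasurableSpace E] [BorelSpace E] {T : E → E} {κ γ c : ℝ} {f g q : E → ℝ}

/-- The conditional expectation, given the state `x` at time `k`, of the weighted sum over the
times in `[k, k + K]` of a function of the chain. -/
noncomputable def valueFun (T : E → E) (γ : ℝ) (w : ℕ → ℝ) (g : E → ℝ) (K k : ℕ) (x : E) : ℝ :=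
  ∑ j ∈ Finset.range (K + 1), w (k + j) * ((langevinOp T γ)^[j] g) x

theorem IsLangevinStep.hasGaussianGrowth_iterate (hT : IsLangevinStep T κ γ) (hc0 : 0 ≤ c)
    (hc : 8 * c ≤ κ) (hf : HasGaussianGrowth c f) (j : ℕ) :
    HasGaussianGrowth c ((langevinOp T γ)^[j] f) := by
  induction j with
  | zero => exact hf
  | succ j ih =>
    rw [Function.iterate_succ_apply']
    exact hT.hasGaussianGrowth_langevinOp hc0 hc ih

theorem IsLangevinStep.hasGaussianGrowth_valueFun (hT : IsLangevinStep T κ γ) (hc0 : 0 ≤ c)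
    (hc : 8 * c ≤ κ) (hf : HasGaussianGrowth c f) (w : ℕ → ℝ) (K k : ℕ) :
    HasGaussianGrowth c (valueFun T γ w f K k) :=
  HasGaussianGrowth.sum _ fun j _ => (hT.hasGaussianGrowth_iterate hc0 hc hf j).const_mul _

omit [BorelSpace E] in
theorem iterate_langevinOp_nonneg (hf : ∀ x, 0 ≤ f x) (j : ℕ) (x : E) :
    0 ≤ ((langevinOp T γ)^[j] f) x := by
  induction j generalizing x with
  | zero => exact hf x
  | succ j ih =>
    rw [Function.iterate_succ_apply']
    exact langevinOp_nonneg ih x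

theorem IsLangevinStep.hasSlopeBound_iterate (hT : IsLangevinStep T κ γ) (hc0 : 0 ≤ c)
    (hc : 8 * c ≤ κ) (hg : HasGaussianGrowth c g) (hq : HasGaussianGrowth c q)
    (hq0 : ∀ x, 0 ≤ q x) (hgq : HasSlopeBound g q) (j : ℕ) :
    HasSlopeBound ((langevinOp T γ)^[j] g)
      (fun x => √(1 - κ * γ) ^ j * ((langevinOp T γ)^[j] q) x) := by
  induction j with
  | zero => simpa using hgq
  | succ j ih =>
    rw [Function.iterate_succ_apply']
    have h := hT.hasSlopeBound_langevinOp (by linarith)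
      (hT.hasGaussianGrowth_iterate hc0 hc hg j)
      ((hT.hasGaussianGrowth_iterate hc0 hc hq j).const_mul (√(1 - κ * γ) ^ j))
      (fun x => mul_nonneg (by positivity) (iterate_langevinOp_nonneg hq0 j x)) ih
    have e : ∀ x, langevinOp T γ (fun x => √(1 - κ * γ) ^ j * ((langevinOp T γ)^[j] q) x) x
        = √(1 - κ * γ) ^ j * ((langevinOp T γ)^[j + 1] q) x := fun x => by
      rw [Function.iterate_succ_apply', langevinOp, integral_const_mul]
      rfl
    intro x y
    refine (h x y).trans_eq ?_
    simp only [e]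
    ring

omit [MeasurableSpace E] [BorelSpace E] [InnerProductSpace ℝ E] [FiniteDimensional ℝ E] in
theorem HasSlopeBound.sum {ι : Type*} (s : Finset ι) {F H : ι → E → ℝ} {a : ι → ℝ}
    (ha : ∀ i, 0 ≤ a i) (h : ∀ i ∈ s, HasSlopeBound (F i) (H i)) :
    HasSlopeBound (fun x => ∑ i ∈ s, a i * F i x) (fun x => ∑ i ∈ s, a i * H i x) := by
  intro x y
  rw [← Finset.sum_sub_distrib, ← Finset.sum_add_distrib, Finset.sum_div, Finset.mul_sum]
  refine (Finset.abs_sum_le_sum_abs _ _).trans (Finset.sum_le_sum fun i hi => ?_)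
  rw [← mul_sub, abs_mul, abs_of_nonneg (ha i)]
  refine (mul_le_mul_of_nonneg_left (h i hi x y) (ha i)).trans_eq ?_
  ring

theorem IsLangevinStep.hasSlopeBound_valueFun (hT : IsLangevinStep T κ γ) (hc0 : 0 ≤ c)
    (hc : 8 * c ≤ κ) (hg : HasGaussianGrowth c g) (hq : HasGaussianGrowth c q)
    (hq0 : ∀ x, 0 ≤ q x) (hgq : HasSlopeBound g q) {w : ℕ → ℝ} (hw : ∀ i, 0 ≤ w i) (K k : ℕ) :
    HasSlopeBound (valueFun T γ w g K k) (fun x => ∑ j ∈ Finset.range (K + 1),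
      w (k + j) * (√(1 - κ * γ) ^ j * ((langevinOp T γ)^[j] q) x)) :=
  HasSlopeBound.sum _ (fun j => hw (k + j)) fun j _ =>
    hT.hasSlopeBound_iterate hc0 hc hg hq hq0 hgq j

theorem IsLangevinStep.valueFun_eq (hT : IsLangevinStep T κ γ) (hc0 : 0 ≤ c)
    (hc : 8 * c ≤ κ) (hg : HasGaussianGrowth c g) {w : ℕ → ℝ} {K : ℕ} (hw : ∀ i, K < i → w i = 0)
    (k : ℕ) (x : E) :
    valueFun T γ w g K k x = w k * g x + langevinOp T γ (valueFun T γ w g K (k + 1)) x := by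
  have h1 : langevinOp T γ (valueFun T γ w g K (k + 1)) x
      = ∑ j ∈ Finset.range (K + 1), w (k + (j + 1)) * ((langevinOp T γ)^[j + 1] g) x := by
    have h := hT.langevinOp_sum (by linarith) (Finset.range (K + 1))
      (F := fun j => (langevinOp T γ)^[j] g)
      (fun j _ => hT.hasGaussianGrowth_iterate hc0 hc hg j) (fun j => w (k + 1 + j)) x
    refine h.trans (Finset.sum_congr rfl fun j _ => ?_)
    rw [Function.iterate_succ_apply', add_assoc k 1 j, add_comm 1 j]
  have h2 := Finset.sum_range_succ' (fun j => w (k + j) * ((langevinOp T γ)^[j] g) x) (K + 1)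
  have h3 := Finset.sum_range_succ (fun j => w (k + j) * ((langevinOp T γ)^[j] g) x) (K + 1)
  -- The sum has fixed length K + 1 for every k; the extra term produced by the shift carries a
  -- weight beyond K, hence zero.
  rw [hw (k + (K + 1)) (by omega), zero_mul, add_zero] at h3
  rw [h1, valueFun, ← h3, h2]
  simp only [add_zero, Function.iterate_zero, id_eq]
  ring

/-- By Jensen, the square of R f is at most R f², whose integral against the law at time k is that
of f² at time k + 1. The bound B holds at all times, so it survives each application of R. -/
theorem IsLangevinStep.integral_sq_iterate_le (hT : IsLangevinStep T κ γ) (hc0 : 0 ≤ c)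
    (hc : 8 * c ≤ κ) (hq : HasGaussianGrowth c q) {B : ℝ}
    (hB : ∀ k, ∫ x, q x ^ 2 ∂(chainLaw T γ k) ≤ B) (j k : ℕ) :
    ∫ x, ((langevinOp T γ)^[j] q) x ^ 2 ∂(chainLaw T γ k) ≤ B := by
  induction j generalizing k with
  | zero => exact hB k
  | succ j ih =>
    have hj := hT.hasGaussianGrowth_iterate hc0 hc hq j
    refine le_trans ?_ (ih (k + 1))
    rw [hT.integral_chainLaw_succ (c := 2 * c) (by linarith) (by linarith) hj.sq]
    rw [Function.iterate_succ_apply']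
    have hR := hT.hasGaussianGrowth_langevinOp hc0 hc hj
    have hRsq : Integrable (langevinOp T γ fun x => ((langevinOp T γ)^[j] q) x ^ 2)
        (chainLaw T γ k) := by
      have hTc := hT.continuous
      have hjc := hj.1
      have := hT.isProbabilityMeasure_chainLaw k
      have h := hT.integrable_chainLaw (c := 2 * c) (by linarith) (by linarith) hj.sq (k + 1)
      rw [chainLaw, integrable_map_measure (by fun_prop) (by fun_prop)] at h
      exact h.integral_prod_left
    exact integral_mono (hT.integrable_chainLaw (c := 2 * c) (by linarith) (by linarith) hR.sq k)
      hRsq fun x => hT.sq_langevinOp_le hc hj hc0 x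

theorem IsLangevinStep.integral_sq_slope_le (hT : IsLangevinStep T κ γ) (hc0 : 0 ≤ c)
    (hc : 8 * c ≤ κ) (hq : HasGaussianGrowth c q) {B : ℝ}
    (hB : ∀ k, ∫ x, q x ^ 2 ∂(chainLaw T γ k) ≤ B) {w : ℕ → ℝ} (hw : ∀ i, 0 ≤ w i) (K k : ℕ) :
    ∫ x, (∑ j ∈ Finset.range (K + 1),
        w (k + j) * (√(1 - κ * γ) ^ j * ((langevinOp T γ)^[j] q) x)) ^ 2 ∂(chainLaw T γ k)
      ≤ B * (∑ j ∈ Finset.range (K + 1), w (k + j) * √(1 - κ * γ) ^ j) ^ 2 := by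
  set a : ℕ → ℝ := fun j => w (k + j) * √(1 - κ * γ) ^ j with ha
  have ha0 : ∀ j, 0 ≤ a j := fun j => mul_nonneg (hw _) (by positivity)
  have hint : ∀ j, Integrable (fun x => ((langevinOp T γ)^[j] q) x ^ 2) (chainLaw T γ k) :=
    fun j => hT.integrable_chainLaw (c := 2 * c) (by linarith) (by linarith)
      (hT.hasGaussianGrowth_iterate hc0 hc hq j).sq k
  -- Cauchy-Schwarz with weights a_j, so that only the second moment of each iterate is needed.
  have hpt : ∀ x, (∑ j ∈ Finset.range (K + 1),
      w (k + j) * (√(1 - κ * γ) ^ j * ((langevinOp T γ)^[j] q) x)) ^ 2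
      ≤ (∑ j ∈ Finset.range (K + 1), a j) *
        ∑ j ∈ Finset.range (K + 1), a j * ((langevinOp T γ)^[j] q) x ^ 2 := fun x =>
    Finset.sum_sq_le_sum_mul_sum_of_sq_le_mul _ (fun j _ => ha0 j)
      (fun j _ => mul_nonneg (ha0 j) (sq_nonneg _)) fun j _ => le_of_eq (by simp only [ha]; ring)
  have hi : Integrable (fun x => (∑ j ∈ Finset.range (K + 1), a j) *
      ∑ j ∈ Finset.range (K + 1), a j * ((langevinOp T γ)^[j] q) x ^ 2) (chainLaw T γ k) :=
    (integrable_finsetSum _ fun j _ => (hint j).const_mul _).const_mul _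
  refine (integral_mono_of_nonneg (.of_forall fun x => sq_nonneg _) hi (.of_forall hpt)).trans ?_
  rw [integral_const_mul, integral_finsetSum _ fun j _ => (hint j).const_mul _, sq, mul_left_comm]
  refine mul_le_mul_of_nonneg_left ?_ (Finset.sum_nonneg fun j _ => ha0 j)
  rw [Finset.mul_sum]
  refine Finset.sum_le_sum fun j _ => ?_
  rw [integral_const_mul, mul_comm B]
  exact mul_le_mul_of_nonneg_left (hT.integral_sq_iterate_le hc0 hc hq hB j k) (ha0 j)

variable {Ω : Type*} [MeasurableSpace Ω] {P : Measure Ω} [IsProbabilityMeasure P]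

omit [IsProbabilityMeasure P] in
theorem integral_add_sq_of_integral_mul_eq_zero {A D : Ω → ℝ} (hA : MemLp A 2 P)
    (hD : MemLp D 2 P) (h : ∫ ω, A ω * D ω ∂P = 0) :
    ∫ ω, (A ω + D ω) ^ 2 ∂P = ∫ ω, A ω ^ 2 ∂P + ∫ ω, D ω ^ 2 ∂P := by
  have hi : Integrable (fun ω => 2 * (A ω * D ω)) P := (hA.integrable_mul hD).const_mul 2
  have e : ∀ ω, (A ω + D ω) ^ 2 = A ω ^ 2 + D ω ^ 2 + 2 * (A ω * D ω) := fun ω => by ring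
  simp_rw [e]
  rw [integral_add _ hi, integral_add hA.integrable_sq hD.integrable_sq, integral_const_mul, h]
  · ring
  · exact hA.integrable_sq.add hD.integrable_sq

/-- The increment of the chain is centred given a variable `A` that is independent of the noise. -/
theorem IsLangevinStep.integral_mul_increment_eq_zero (hT : IsLangevinStep T κ γ)
    (hc : 4 * c ≤ κ) (hf : HasGaussianGrowth c f)
    (hfR : Continuous (langevinOp T γ f)) {Y : Ω → E} {A : Ω → ℝ} {w : Ω → E}
    (hY : Measurable Y) (hA : Measurable A) (hw : Measurable w)
    (hlaw : P.map w = stdGaussian E) (hind : IndepFun (fun ω => (Y ω, A ω)) w P)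
    (hi : Integrable (fun ω =>
      A ω * (f (T (Y ω) + √(2 * γ) • w ω) - langevinOp T γ f (Y ω))) P) :
    ∫ ω, A ω * (f (T (Y ω) + √(2 * γ) • w ω) - langevinOp T γ f (Y ω)) ∂P = 0 := by
  have hTc := hT.continuous
  have hfc := hf.1
  have hYA : Measurable fun ω => (Y ω, A ω) := hY.prodMk hA
  have := Measure.isProbabilityMeasure_map (μ := P) hYA.aemeasurable
  have hmap : P.map (fun ω => ((Y ω, A ω), w ω))
      = (P.map fun ω => (Y ω, A ω)).prod (stdGaussian E) := by
    rw [← hlaw]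
    exact (indepFun_iff_map_prod_eq_prod_map_map hYA.aemeasurable hw.aemeasurable).1 hind
  set F : (E × ℝ) × E → ℝ := fun p =>
    p.1.2 * (f (T p.1.1 + √(2 * γ) • p.2) - langevinOp T γ f p.1.1) with hF
  have hFm : Measurable F := by fun_prop
  have hJ : Measurable fun ω => ((Y ω, A ω), w ω) := hYA.prodMk hw
  have e1 : ∫ ω, A ω * (f (T (Y ω) + √(2 * γ) • w ω) - langevinOp T γ f (Y ω)) ∂P
      = ∫ p, F p ∂(P.map fun ω => ((Y ω, A ω), w ω)) := by
    rw [integral_map hJ.aemeasurable hFm.aestronglyMeasurable]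
  have hi' : Integrable F (P.map fun ω => ((Y ω, A ω), w ω)) := by
    rw [integrable_map_measure hFm.aestronglyMeasurable hJ.aemeasurable]
    exact hi
  rw [e1, hmap, integral_prod _ (hmap ▸ hi')]
  refine integral_eq_zero_of_ae (.of_forall fun p => ?_)
  simp only [hF, Pi.zero_apply]
  rw [integral_const_mul, integral_sub (hT.integrable hc hf _) (integrable_const _)]
  simp [langevinOp]

variable {X W : ℕ → Ω → E}

omit [MeasurableSpace Ω] in
-- The state at time j uses the noises of index below j, so the past at time k omits `W k`, the
-- noise of the next step.
theorem measurable_iSup_comap_chain (hTc : Continuous T) (hX0 : ∀ ω, X 0 ω = 0)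
    (hX : ∀ k ω, X (k + 1) ω = T (X k ω) + √(2 * γ) • W k ω) (k j : ℕ) (hj : j ≤ k) :
    Measurable[⨆ i ∈ Set.Iio k, MeasurableSpace.comap (W i) inferInstance] (X j) := by
  induction j with
  | zero =>
    rw [show X 0 = fun _ => 0 from funext hX0]
    exact measurable_const
  | succ j ih =>
    rw [show X (j + 1) = fun ω => T (X j ω) + √(2 * γ) • W j ω from funext (hX j)]
    have hW : Measurable[⨆ i ∈ Set.Iio k, MeasurableSpace.comap (W i) inferInstance] (W j) := by
      refine Measurable.mono (comap_measurable (W j)) ?_ le_rfl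
      exact le_iSup₂_of_le (f := fun i (_ : i ∈ Set.Iio k) =>
        MeasurableSpace.comap (W i) inferInstance) j (by simp; omega) le_rfl
    exact (hTc.measurable.comp (ih (by omega))).add (hW.const_smul _)

omit [NormedAddCommGroup E] [InnerProductSpace ℝ E] [FiniteDimensional ℝ E] [BorelSpace E]
  [IsProbabilityMeasure P] in
theorem indepFun_of_measurable_past (hWm : ∀ k, Measurable (W k)) (hW : iIndepFun W P) {k : ℕ}
    {β : Type*} [MeasurableSpace β] {Y : Ω → β}
    (hY : Measurable[⨆ i ∈ Set.Iio k, MeasurableSpace.comap (W i) inferInstance] Y) :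
    IndepFun Y (W k) P := by
  have h := indep_iSup_of_disjoint (fun i => (hWm i).comap_le) hW
    (S := Set.Iio k) (T := {k}) (by simp)
  rw [IndepFun_iff_Indep]
  refine indep_of_indep_of_le_left (indep_of_indep_of_le_right h ?_) hY.comap_le
  exact le_iSup₂_of_le (f := fun i (_ : i ∈ ({k} : Set ℕ)) =>
        MeasurableSpace.comap (W i) inferInstance) k rfl le_rfl

theorem IsLangevinStep.map_chain_eq (hT : IsLangevinStep T κ γ) (hWm : ∀ k, Measurable (W k))
    (hWl : ∀ k, P.map (W k) = stdGaussian E) (hW : iIndepFun W P) (hX0 : ∀ ω, X 0 ω = 0)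
    (hX : ∀ k ω, X (k + 1) ω = T (X k ω) + √(2 * γ) • W k ω) (hXm : ∀ k, Measurable (X k))
    (k : ℕ) : P.map (X k) = chainLaw T γ k := by
  have hTc := hT.continuous
  induction k with
  | zero =>
    rw [show X 0 = fun _ => 0 from funext hX0, Measure.map_const]
    simp [chainLaw]
  | succ k ih =>
    have hind := indepFun_of_measurable_past hWm hW
      (measurable_iSup_comap_chain hTc hX0 hX k k le_rfl)
    have hmap := (indepFun_iff_map_prod_eq_prod_map_map (hXm k).aemeasurable
      (hWm k).aemeasurable).1 hind
    rw [ih, hWl k] at hmap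
    rw [chainLaw, ← hmap, Measure.map_map (by fun_prop) ((hXm k).prodMk (hWm k))]
    congr 1
    exact funext (hX k)

/-- Variance bound for weighted sums along the chain. -/
theorem IsLangevinStep.variance_sum_le (hT : IsLangevinStep T κ γ) (hc0 : 0 ≤ c)
    (hc : 8 * c ≤ κ) (hcγ : 4 * c * γ < 1 / 4) (hg : HasGaussianGrowth c g)
    (hq : HasGaussianGrowth c q) (hq0 : ∀ x, 0 ≤ q x) (hgq : HasSlopeBound g q) {B : ℝ}
    (hB : ∀ k, ∫ x, q x ^ 2 ∂(chainLaw T γ k) ≤ B) {w : ℕ → ℝ} (hw0 : ∀ i, 0 ≤ w i) {K : ℕ}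
    (hw : ∀ i, K < i → w i = 0) (hWm : ∀ k, Measurable (W k))
    (hWl : ∀ k, P.map (W k) = stdGaussian E) (hW : iIndepFun W P) (hX0 : ∀ ω, X 0 ω = 0)
    (hX : ∀ k ω, X (k + 1) ω = T (X k ω) + √(2 * γ) • W k ω) :
    MemLp (fun ω => ∑ k ∈ Finset.range (K + 1), w k * g (X k ω)) 2 P ∧
      Var[fun ω => ∑ k ∈ Finset.range (K + 1), w k * g (X k ω); P]
        ≤ 2 * γ * (B * ∑ k ∈ Finset.range (K + 1),
          (∑ j ∈ Finset.range (K + 1), w (k + 1 + j) * √(1 - κ * γ) ^ j) ^ 2) := by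
  have hTc := hT.continuous
  have hγ := hT.step_pos
  have hsup : ∀ k, (⨆ i ∈ Set.Iio k, MeasurableSpace.comap (W i) inferInstance)
      ≤ (inferInstance : MeasurableSpace Ω) := fun k =>
    iSup₂_le fun i _ => (hWm i).comap_le
  have hpast := measurable_iSup_comap_chain (γ := γ) hTc hX0 hX
  have hXm : ∀ k, Measurable (X k) := fun k => (hpast k k le_rfl).mono (hsup k) le_rfl
  have hXl := hT.map_chain_eq hWm hWl hW hX0 hX hXm
  have hL2 : ∀ {f : E → ℝ}, HasGaussianGrowth c f → ∀ k, MemLp (fun ω => f (X k ω)) 2 P := by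
    intro f hf k
    have hfc := hf.1
    rw [memLp_two_iff_integrable_sq (by fun_prop)]
    have h := hT.integrable_chainLaw (c := 2 * c) (by linarith) (by linarith) hf.sq k
    rw [← hXl k, integrable_map_measure (by fun_prop) (by fun_prop)] at h
    exact h
  have hintX : ∀ {f : E → ℝ}, Continuous f → ∀ k,
      ∫ ω, f (X k ω) ∂P = ∫ x, f x ∂(chainLaw T γ k) := by
    intro f hf k
    rw [← hXl k, integral_map (by fun_prop) (by fun_prop)]
  set V := valueFun T γ w g K with hV
  have hVg : ∀ k, HasGaussianGrowth c (V k) := fun k =>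
    hT.hasGaussianGrowth_valueFun hc0 hc hg w K k
  have hRg : ∀ k, HasGaussianGrowth c (langevinOp T γ (V k)) := fun k =>
    hT.hasGaussianGrowth_langevinOp hc0 hc (hVg k)
  -- Z k is the conditional expectation of the whole sum given the first k noises, minus its mean: a
  -- martingale started at 0.
  set Z : ℕ → Ω → ℝ := fun k ω =>
    V k (X k ω) - V 0 (X 0 ω) + ∑ j ∈ Finset.range k, w j * g (X j ω) with hZ
  have hsumL2 : ∀ k, MemLp (fun ω => ∑ j ∈ Finset.range k, w j * g (X j ω)) 2 P := fun k =>
    memLp_finsetSum _ fun j _ => (hL2 hg j).const_mul (w j)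
  have hZL2 : ∀ k, MemLp (Z k) 2 P := fun k =>
    ((hL2 (hVg k) k).sub (hL2 (hVg 0) 0)).add (hsumL2 k)
  have hZm : ∀ k, Measurable[⨆ i ∈ Set.Iio k, MeasurableSpace.comap (W i) inferInstance] (Z k) := by
    intro k
    refine (((hVg k).1.measurable.comp (hpast k k le_rfl)).sub
      ((hVg 0).1.measurable.comp (hpast k 0 (Nat.zero_le k)))).add ?_
    refine Finset.measurable_fun_sum _ fun j hj => ?_
    exact (hg.1.measurable.comp (hpast k j (Finset.mem_range.1 hj).le)).const_mul (w j)
  have hstep : ∀ k ω, Z (k + 1) ω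
      = Z k ω + (V (k + 1) (X (k + 1) ω) - langevinOp T γ (V (k + 1)) (X k ω)) := by
    intro k ω
    have h := hT.valueFun_eq hc0 hc hg hw k (X k ω)
    simp only [hZ, Finset.sum_range_succ]
    rw [← hV] at h
    rw [h]
    ring
  have hbound : ∀ k, ∫ ω, Z k ω ^ 2 ∂P ≤ 2 * γ * (B * ∑ k ∈ Finset.range k,
      (∑ j ∈ Finset.range (K + 1), w (k + 1 + j) * √(1 - κ * γ) ^ j) ^ 2) := by
    intro k
    induction k with
    | zero => simp [hZ]
    | succ k ih =>
      set D : Ω → ℝ := fun ω => V (k + 1) (X (k + 1) ω) - langevinOp T γ (V (k + 1)) (X k ω)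
        with hD
      have hDL2 : MemLp D 2 P := (hL2 (hVg (k + 1)) (k + 1)).sub (hL2 (hRg (k + 1)) k)
      -- Used twice: with the current martingale value, for the Pythagorean recursion, and with R
      -- V_{k+1}(X_k), to write E D² as a mean conditional variance.
      have horth : ∀ A : Ω → ℝ, MemLp A 2 P →
          Measurable[⨆ i ∈ Set.Iio k, MeasurableSpace.comap (W i) inferInstance] A →
          ∫ ω, A ω * D ω ∂P = 0 := by
        intro A hA hAm
        have hi : Integrable (fun ω => A ω * D ω) P := hA.integrable_mul hDL2
        have hind := indepFun_of_measurable_past hWm hW ((hpast k k le_rfl).prodMk hAm)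
        simp only [hD, hX k] at hi ⊢
        exact hT.integral_mul_increment_eq_zero (by linarith) (hVg (k + 1)) (hRg (k + 1)).1
          (hXm k) (hAm.mono (hsup k) le_rfl) (hWm k) (hWl k) hind hi
      have hRL2 := hL2 (hRg (k + 1)) k
      have o1 := horth (Z k) (hZL2 k) (hZm k)
      have o2 := horth _ hRL2 ((hRg (k + 1)).1.measurable.comp (hpast k k le_rfl))
      have e1 : ∫ ω, Z (k + 1) ω ^ 2 ∂P = ∫ ω, Z k ω ^ 2 ∂P + ∫ ω, D ω ^ 2 ∂P := by
        simp_rw [hstep k]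
        exact integral_add_sq_of_integral_mul_eq_zero (hZL2 k) hDL2 o1
      have e2 : ∫ ω, V (k + 1) (X (k + 1) ω) ^ 2 ∂P
          = ∫ ω, langevinOp T γ (V (k + 1)) (X k ω) ^ 2 ∂P + ∫ ω, D ω ^ 2 ∂P := by
        rw [← integral_add_sq_of_integral_mul_eq_zero hRL2 hDL2 o2]
        simp only [hD, add_sub_cancel]
      set H : E → ℝ := fun x => ∑ j ∈ Finset.range (K + 1),
        w (k + 1 + j) * (√(1 - κ * γ) ^ j * ((langevinOp T γ)^[j] q) x) with hH
      have hHg : HasGaussianGrowth c H := HasGaussianGrowth.sum _ fun j _ =>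
        ((hT.hasGaussianGrowth_iterate hc0 hc hq j).const_mul _).const_mul _
      have hH0 : ∀ x, 0 ≤ H x := fun x => Finset.sum_nonneg fun j _ =>
        mul_nonneg (hw0 _) (mul_nonneg (by positivity) (iterate_langevinOp_nonneg hq0 j x))
      have hVH : HasSlopeBound (V (k + 1)) H :=
        hT.hasSlopeBound_valueFun hc0 hc hg hq hq0 hgq hw0 K (k + 1)
      have hprob := hT.isProbabilityMeasure_chainLaw k
      have hRint : ∀ {f : E → ℝ}, HasGaussianGrowth c f →
          Integrable (langevinOp T γ fun x => f x ^ 2) (chainLaw T γ k) := by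
        intro f hf
        have hfc := hf.1
        have h := hT.integrable_chainLaw (c := 2 * c) (by linarith) (by linarith) hf.sq (k + 1)
        rw [chainLaw, integrable_map_measure (by fun_prop) (by fun_prop)] at h
        exact h.integral_prod_left
      have hDle : ∫ ω, D ω ^ 2 ∂P ≤ 2 * γ * (B *
          (∑ j ∈ Finset.range (K + 1), w (k + 1 + j) * √(1 - κ * γ) ^ j) ^ 2) := by
        have h1 : ∫ ω, D ω ^ 2 ∂P = ∫ x, (langevinOp T γ (fun y => V (k + 1) y ^ 2) x
            - langevinOp T γ (V (k + 1)) x ^ 2) ∂(chainLaw T γ k) := by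
          rw [integral_sub (hRint (hVg (k + 1)))
            (hT.integrable_chainLaw (c := 2 * c) (by linarith) (by linarith) (hRg (k + 1)).sq k),
            ← hT.integral_chainLaw_succ (c := 2 * c) (by linarith) (by linarith) (hVg (k + 1)).sq,
            ← hintX (f := fun x => V (k + 1) x ^ 2) ((hVg (k + 1)).1.pow 2),
            ← hintX (f := fun x => langevinOp T γ (V (k + 1)) x ^ 2) ((hRg (k + 1)).1.pow 2), e2]
          ring
        rw [h1]
        refine (integral_mono ((hRint (hVg (k + 1))).sub
          (hT.integrable_chainLaw (c := 2 * c) (by linarith) (by linarith) (hRg (k + 1)).sq k))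
          ((hRint hHg).const_mul (2 * γ)) fun x =>
            hT.local_poincare hc0 (by linarith) hcγ (hVg (k + 1)) hHg hH0 hVH x).trans ?_
        rw [integral_const_mul]
        refine mul_le_mul_of_nonneg_left ?_ (by positivity)
        rw [← hT.integral_chainLaw_succ (c := 2 * c) (by linarith) (by linarith) hHg.sq]
        exact hT.integral_sq_slope_le hc0 hc hq hB hw0 K (k + 1)
      rw [e1, Finset.sum_range_succ, mul_add, mul_add]
      exact add_le_add ih hDle
  refine ⟨hsumL2 (K + 1), ?_⟩
  -- After time K nothing remains to be summed, so Z (K + 1) is the sum minus the constant V 0 0.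
  have hVK : ∀ x, V (K + 1) x = 0 := fun x => by
    simp only [hV, valueFun]
    refine Finset.sum_eq_zero fun j _ => ?_
    rw [hw _ (by omega), zero_mul]
  have hvar : Var[fun ω => ∑ k ∈ Finset.range (K + 1), w k * g (X k ω); P] = Var[Z (K + 1); P] := by
    have e : Z (K + 1) = fun ω => (∑ k ∈ Finset.range (K + 1), w k * g (X k ω)) - V 0 0 := by
      funext ω
      simp only [hZ, hVK, hX0]
      ring
    rw [e, variance_sub_const (hsumL2 (K + 1)).1]
  rw [hvar]
  exact (variance_le_expectation_sq (hZL2 (K + 1)).1).trans (hbound (K + 1))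

end Chain


/-! ### Geometric sums of the window weights -/

section Weights

/-- The weight at k + 1 + j vanishes until j ≥ N - k. The truncated subtraction gives exponent 0
once the burn-in is over. -/
theorem sum_shifted_weights_le {w : ℕ → ℝ} {b ρ : ℝ} {N : ℕ} (hw : ∀ i, w i ≤ b)
    (hb : 0 ≤ b) (hwN : ∀ i ≤ N, w i = 0) (h0 : 0 ≤ ρ) (h1 : ρ < 1) (J k : ℕ) :
    ∑ j ∈ Finset.range J, w (k + 1 + j) * ρ ^ j ≤ b * (ρ ^ (N - k) / (1 - ρ)) := by
  have hsub : Finset.Ico (N - k) J ⊆ Finset.range J := fun j hj => by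
    simp only [Finset.mem_Ico, Finset.mem_range] at hj ⊢; omega
  rw [← Finset.sum_subset hsub fun j hj hj' => ?_]
  · calc ∑ j ∈ Finset.Ico (N - k) J, w (k + 1 + j) * ρ ^ j
        ≤ ∑ j ∈ Finset.Ico (N - k) J, b * ρ ^ j :=
          Finset.sum_le_sum fun j _ => mul_le_mul_of_nonneg_right (hw _) (by positivity)
      _ = b * ∑ j ∈ Finset.Ico (N - k) J, ρ ^ j := by rw [Finset.mul_sum]
      _ ≤ _ := mul_le_mul_of_nonneg_left (geom_sum_Ico_le_of_lt_one h0 h1) hb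
  · simp only [Finset.mem_Ico, Finset.mem_range, not_and, not_lt] at hj hj'
    rw [hwN _ (by omega), zero_mul]

/-- The N burn-in times contribute a geometric series, the next n times contribute at most 1 each,
in units of (b/(1 - ρ))², and the last time contributes nothing. -/
theorem sum_sq_shifted_weights_le {w : ℕ → ℝ} {b ρ : ℝ} {N n : ℕ} (hw0 : ∀ i, 0 ≤ w i)
    (hw : ∀ i, w i ≤ b) (hwN : ∀ i ≤ N, w i = 0) (hwn : ∀ i, N + n < i → w i = 0)
    (h0 : 0 ≤ ρ) (h1 : ρ < 1) :
    ∑ k ∈ Finset.range (N + n + 1),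
      (∑ j ∈ Finset.range (N + n + 1), w (k + 1 + j) * ρ ^ j) ^ 2
      ≤ (b / (1 - ρ)) ^ 2 * (n + 1 / (1 - ρ ^ 2)) := by
  have hb : 0 ≤ b := (hw0 0).trans (hw 0)
  have h1' : 0 < 1 - ρ := by linarith
  have hS0 : ∀ k, 0 ≤ ∑ j ∈ Finset.range (N + n + 1), w (k + 1 + j) * ρ ^ j := fun k =>
    Finset.sum_nonneg fun j _ => mul_nonneg (hw0 _) (by positivity)
  have hS : ∀ k, (∑ j ∈ Finset.range (N + n + 1), w (k + 1 + j) * ρ ^ j) ^ 2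
      ≤ (b / (1 - ρ)) ^ 2 * (ρ ^ 2) ^ (N - k) := fun k => by
    refine (pow_le_pow_left₀ (hS0 k) (sum_shifted_weights_le hw hb hwN h0 h1 _ k) 2).trans_eq ?_
    rw [← pow_mul, mul_comm 2, pow_mul]
    ring
  rw [Finset.sum_range_succ, Finset.sum_range_add]
  have hlast : ∑ j ∈ Finset.range (N + n + 1), w (N + n + 1 + j) * ρ ^ j = 0 :=
    Finset.sum_eq_zero fun j _ => by rw [hwn _ (by omega), zero_mul]
  rw [hlast]
  have hA : ∑ k ∈ Finset.range N, (∑ j ∈ Finset.range (N + n + 1), w (k + 1 + j) * ρ ^ j) ^ 2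
      ≤ (b / (1 - ρ)) ^ 2 * (1 / (1 - ρ ^ 2)) := by
    have hρ2 : ρ ^ 2 < 1 := by nlinarith
    refine (Finset.sum_le_sum fun k _ => hS k).trans ?_
    rw [← Finset.mul_sum]
    refine mul_le_mul_of_nonneg_left ?_ (sq_nonneg _)
    have h2 : ∑ k ∈ Finset.range N, (ρ ^ 2) ^ (N - k)
        ≤ ∑ k ∈ Finset.range N, (ρ ^ 2) ^ (N - 1 - k) := by
      refine Finset.sum_le_sum fun k _ => ?_
      exact pow_le_pow_of_le_one (sq_nonneg _) hρ2.le (by omega)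
    refine h2.trans ?_
    rw [Finset.sum_range_reflect (fun k => (ρ ^ 2) ^ k) N, Finset.range_eq_Ico]
    refine (geom_sum_Ico_le_of_lt_one (sq_nonneg _) hρ2).trans_eq ?_
    rw [pow_zero]
  have hB : ∑ k ∈ Finset.range n,
      (∑ j ∈ Finset.range (N + n + 1), w (N + k + 1 + j) * ρ ^ j) ^ 2
      ≤ (b / (1 - ρ)) ^ 2 * n := by
    refine (Finset.sum_le_sum fun k _ => hS (N + k)).trans ?_
    simp [mul_comm]
  rw [mul_add]
  linarith

end Weights

/-! ### Slope and moments of the tilt function -/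

section Tilt

/-- Equivalent to tanh(u/2) ≤ u/2. The difference of the two sides vanishes at 0 and has derivative
1 - (1 - t)e^t, which is nonnegative since 1 - t ≤ e^{-t}. -/
theorem exp_mul_two_sub_le {u : ℝ} (hu : 0 ≤ u) : Real.exp u * (2 - u) ≤ 2 + u := by
  have hd : ∀ t : ℝ, HasDerivAt (fun t : ℝ => 2 + t - Real.exp t * (2 - t))
      (1 - (Real.exp t * (2 - t) + Real.exp t * (-1))) t := fun t =>
    ((hasDerivAt_id t).const_add 2).sub
      ((Real.hasDerivAt_exp t).mul ((hasDerivAt_id t).const_sub 2))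
  have hmono : MonotoneOn (fun t : ℝ => 2 + t - Real.exp t * (2 - t)) (Set.Ici 0) := by
    refine monotoneOn_of_deriv_nonneg (convex_Ici 0)
      (fun t _ => (hd t).continuousAt.continuousWithinAt)
      (fun t _ => (hd t).differentiableAt.differentiableWithinAt) fun t _ => ?_
    rw [(hd t).deriv]
    have h1 := Real.add_one_le_exp (-t)
    have h2 : Real.exp t * Real.exp (-t) = 1 := by rw [← Real.exp_add]; simp
    nlinarith [Real.exp_pos t]
  have h := hmono (Set.self_mem_Ici) hu hu
  simp only [add_zero, Real.exp_zero, sub_zero, one_mul, sub_self] at h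
  linarith

/-- The trapezoid rule overestimates the integral of the convex function 2ar exp(ar²), r ≥ 0. -/
theorem exp_sq_sub_exp_sq_le {a r t : ℝ} (ha : 0 ≤ a) (hr : 0 ≤ r) (hrt : r ≤ t) :
    Real.exp (a * t ^ 2) - Real.exp (a * r ^ 2)
      ≤ (t - r) * ((2 * a * r * Real.exp (a * r ^ 2) + 2 * a * t * Real.exp (a * t ^ 2)) / 2) := by
  rcases hrt.eq_or_lt with rfl | hlt
  · simp
  set u := a * (t ^ 2 - r ^ 2) with hu
  have hu0 : 0 ≤ u := mul_nonneg ha (by nlinarith)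
  have e : Real.exp (a * t ^ 2) = Real.exp (a * r ^ 2) * Real.exp u := by
    rw [← Real.exp_add, hu]; ring_nf
  have ht : 0 < t + r := by linarith
  have h1 := exp_mul_two_sub_le hu0
  have h2 : 0 ≤ Real.exp u - 1 - u := by linarith [Real.add_one_le_exp u]
  have key : (Real.exp u - 1) * (t + r) ≤ u * (r + t * Real.exp u) := by
    nlinarith [mul_nonneg (sub_nonneg.2 hrt) h2]
  have h3 : u = a * (t - r) * (t + r) := by rw [hu]; ring
  have key2 : Real.exp u - 1 ≤ a * (t - r) * (r + t * Real.exp u) := by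
    refine le_of_mul_le_mul_right ?_ ht
    refine key.trans_eq ?_
    conv_lhs => rw [h3]
    rw [← h3]
    ring
  rw [e]
  nlinarith [Real.exp_pos (a * r ^ 2)]

variable {d : ℕ} {a : ℝ}

/-- The function is radial, so the one-dimensional bound combines with the reverse triangle
inequality. -/
theorem hasSlopeBound_tiltFun (ha : 0 ≤ a) :
    HasSlopeBound (tiltFun a : EuclideanSpace ℝ (Fin d) → ℝ)
      (fun x => 2 * a * ‖x‖ * Real.exp (a * ‖x‖ ^ 2)) := by
  have key : ∀ x y : EuclideanSpace ℝ (Fin d), ‖y‖ ≤ ‖x‖ →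
      |tiltFun a x - tiltFun a y| ≤ ‖x - y‖ * ((2 * a * ‖x‖ * Real.exp (a * ‖x‖ ^ 2)
        + 2 * a * ‖y‖ * Real.exp (a * ‖y‖ ^ 2)) / 2) := by
    intro x y hxy
    have h1 := exp_sq_sub_exp_sq_le ha (norm_nonneg y) hxy
    have h2 : 0 ≤ tiltFun a x - tiltFun a y := by
      unfold tiltFun
      rw [sub_nonneg]
      gcongr
    rw [abs_of_nonneg h2]
    refine h1.trans ?_
    rw [add_comm]
    exact mul_le_mul_of_nonneg_right (norm_sub_norm_le x y) (by positivity)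
  intro x y
  rcases le_total ‖y‖ ‖x‖ with h | h
  · exact key x y h
  · rw [abs_sub_comm, norm_sub_rev, add_comm]
    exact key y x h

theorem hasGaussianGrowth_tiltFun (ha : 0 ≤ a) :
    HasGaussianGrowth (2 * a) (tiltFun a : EuclideanSpace ℝ (Fin d) → ℝ) := by
  refine ⟨by unfold tiltFun; fun_prop, 1, fun x => ?_⟩
  rw [tiltFun, Real.abs_exp, one_mul]
  gcongr
  linarith

theorem hasGaussianGrowth_slope_tiltFun (ha : 0 ≤ a) :
    HasGaussianGrowth (2 * a)
      (fun x : EuclideanSpace ℝ (Fin d) => 2 * a * ‖x‖ * Real.exp (a * ‖x‖ ^ 2)) := by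
  refine ⟨by fun_prop, a + 1, fun x => ?_⟩
  have e : Real.exp (2 * a * ‖x‖ ^ 2) = Real.exp (a * ‖x‖ ^ 2) * Real.exp (a * ‖x‖ ^ 2) := by
    rw [← Real.exp_add]; ring_nf
  rw [abs_of_nonneg (by positivity), e, ← mul_assoc]
  refine mul_le_mul_of_nonneg_right ?_ (Real.exp_nonneg _)
  have h1 := Real.add_one_le_exp (a * ‖x‖ ^ 2)
  have h2 : 1 ≤ Real.exp (a * ‖x‖ ^ 2) := Real.one_le_exp (by positivity)
  nlinarith [sq_nonneg (‖x‖ - 1), mul_nonneg ha (sq_nonneg (‖x‖ - 1)),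
    mul_nonneg ha (sub_nonneg.2 h2)]

theorem IsLangevinStep.integral_sq_slope_tiltFun_le
    {T : EuclideanSpace ℝ (Fin d) → EuclideanSpace ℝ (Fin d)} {κ γ : ℝ}
    (hT : IsLangevinStep T κ γ) (ha : 0 ≤ a) (haκ : 8 * a < κ) (k : ℕ) :
    ∫ x, (2 * a * ‖x‖ * Real.exp (a * ‖x‖ ^ 2)) ^ 2 ∂(chainLaw T γ k)
      ≤ 4 * a ^ 2 * (constC0 d κ a * constC1 d κ a γ) := by
  -- Squaring the slope doubles the exponent to 2a, which is then both c and A; α = 0 and β = 1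
  -- select the factor ‖x‖².
  have h := hT.moment_le (A := 2 * a) (by linarith) k (c := 2 * a) (α := 0) (β := 1)
    (by linarith) le_rfl le_rfl zero_le_one
  have e : ∀ x : EuclideanSpace ℝ (Fin d), (2 * a * ‖x‖ * Real.exp (a * ‖x‖ ^ 2)) ^ 2
      = 4 * a ^ 2 * ((0 + 1 * ‖x‖ ^ 2) * Real.exp (2 * a * ‖x‖ ^ 2)) := fun x => by
    rw [mul_pow, ← Real.exp_nat_mul]
    push_cast
    ring_nf
  simp_rw [e]
  rw [integral_const_mul]
  refine mul_le_mul_of_nonneg_left (h.trans_eq ?_) (by positivity)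
  rw [finrank_euclideanSpace_fin, constC0, constC1]
  ring_nf

end Tilt

/-! ### Consequences of the variance condition -/

section Constants

variable {d : ℕ} {m : ℝ} {s s' : ℝ≥0∞}

theorem precision_pos (hs : s ≠ ⊤) (hs0 : 0 < s) : 0 < precision s :=
  ENNReal.toReal_pos (by simpa using hs) (by simpa using hs0.ne')

theorem tilt_nonneg (hs0 : 0 < s) (h : s ≤ s') : 0 ≤ tilt s s' := by
  have : precision s' ≤ precision s :=
    ENNReal.toReal_mono (by simpa using hs0.ne') (ENNReal.inv_le_inv.2 h)
  unfold tilt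
  linarith

theorem tilt_le (hs0 : 0 < s') (h : VarianceCondition d m s s') :
    tilt s s' * (4 * d + 16) ≤ m + precision s := by
  have hp : 0 ≤ precision s := precision_nonneg s
  have hp' : 0 ≤ precision s' := precision_nonneg s'
  have hd : (0 : ℝ) ≤ d := d.cast_nonneg
  -- The variance condition read on precisions; a nonpositive left side corresponds to a vacuous
  -- condition. Subtracting from (2d + 8) `precision s` leaves m + `precision s`.
  have key : (2 * d + 7) * precision s - m ≤ precision s' * (2 * d + 8) := by
    rcases le_or_gt ((2 * d + 7) * precision s - m) 0 with hq | hq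
    · exact hq.trans (by positivity)
    · have h1 := ENNReal.inv_le_inv.2 h
      have e : 2 * ((d : ℝ≥0∞) + 4) = ENNReal.ofReal (2 * d + 8) := by
        rw [ENNReal.ofReal_add (by positivity) (by positivity), ENNReal.ofReal_mul (by positivity),
          ENNReal.ofReal_natCast]
        simp only [ENNReal.ofReal_ofNat]
        ring
      rw [e, ← ENNReal.ofReal_inv_of_pos hq, ← ENNReal.ofReal_mul (by positivity),
        ← ENNReal.ofReal_inv_of_pos (by positivity)] at h1
      have h2 := ENNReal.toReal_mono (by simpa using hs0.ne') h1
      rw [ENNReal.toReal_ofReal (by positivity), mul_inv, inv_inv, inv_mul_eq_div,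
        div_le_iff₀ (by positivity)] at h2
      exact h2
  unfold tilt
  nlinarith

end Constants

/-! ### Estimator as a weighted sum and final constants -/

section Main

variable {d : ℕ} {Ω : Type*}

theorem ulaChain_congr {V : EuclideanSpace ℝ (Fin d) → ℝ} {γ : ℝ}
    {W W' : ℕ → Ω → EuclideanSpace ℝ (Fin d)} {ω : Ω} (h : ∀ k, W k ω = W' k ω) (k : ℕ) :
    ulaChain V γ W k ω = ulaChain V γ W' k ω := by
  induction k with
  | zero => rfl
  | succ k ih => simp only [ulaChain, ih, h]

/-- The weights of the estimator. -/
noncomputable def windowWeight (N n i : ℕ) : ℝ :=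
  if i ∈ Finset.Icc (N + 1) (N + n) then 1 / n else 0

theorem ulaEstimator_eq_sum (X : ℕ → Ω → EuclideanSpace ℝ (Fin d))
    (g : EuclideanSpace ℝ (Fin d) → ℝ) (N n : ℕ) (ω : Ω) :
    ulaEstimator X g N n ω
      = ∑ k ∈ Finset.range (N + n + 1), windowWeight N n k * g (X k ω) := by
  have hsub : Finset.Icc (N + 1) (N + n) ⊆ Finset.range (N + n + 1) := fun j hj => by
    simp only [Finset.mem_Icc, Finset.mem_range] at hj ⊢; omega
  rw [ulaEstimator, Finset.mul_sum, ← Finset.sum_subset hsub]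
  · exact Finset.sum_congr rfl fun k hk => by rw [windowWeight, if_pos hk]
  · intro k _ hk
    rw [windowWeight, if_neg hk, zero_mul]

theorem variance_constant_le {a κ γ n C0 C1 ρ : ℝ} (hκ : 0 < κ) (hγ : 0 < γ) (hn : 0 < n)
    (hC0 : 0 ≤ C0) (hC1 : 0 ≤ C1) (hρ1 : ρ < 1) (hρ : ρ ^ 2 = 1 - κ * γ) :
    2 * γ * (4 * a ^ 2 * (C0 * C1) * ((1 / n / (1 - ρ)) ^ 2 * (n + 1 / (1 - ρ ^ 2))))
      ≤ 32 * a ^ 2 * C0 * C1 / (κ ^ 2 * n * γ) * (1 + 2 / (κ * n * γ)) := by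
  have hδ : 0 < κ * γ := by positivity
  -- From (1 - ρ)(1 + ρ) = κγ and 1 + ρ < 2.
  have h1 : κ * γ / 2 ≤ 1 - ρ := by nlinarith
  have h2 : 1 / n / (1 - ρ) ≤ 1 / n / (κ * γ / 2) := by gcongr
  have h3 : (1 / n / (1 - ρ)) ^ 2 ≤ (1 / n / (κ * γ / 2)) ^ 2 := by
    have : 0 < 1 - ρ := by linarith
    gcongr
  -- Here 1/(1 - ρ²) = 1/(κγ) already; the factor 2 is slack that matches the stated constant.
  have h4 : n + 1 / (1 - ρ ^ 2) ≤ n + 2 / (κ * γ) := by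
    rw [hρ, sub_sub_cancel]
    gcongr
    norm_num
  calc _ ≤ 2 * γ * (4 * a ^ 2 * (C0 * C1) *
        ((1 / n / (κ * γ / 2)) ^ 2 * (n + 2 / (κ * γ)))) := by
        have h5 : 0 ≤ n + 1 / (1 - ρ ^ 2) := by rw [hρ, sub_sub_cancel]; positivity
        gcongr
    _ = _ := by field_simp; ring

end Main

end AnnealedULA

theorem mainTheorem12
    {d : ℕ} (hd : 1 ≤ d) {L m : ℝ} (hm : 0 ≤ m)
    (U : EuclideanSpace ℝ (Fin d) → ℝ)
    (hUL : AnnealedULA.GradientLipschitz L U)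
    (hUm : AnnealedULA.GradientConvex m U)
    (hU0 : ∀ x, U 0 ≤ U x)
    {M : ℕ} (σsq : Fin (M + 1) → ℝ≥0∞)
    (hσ_pos : ∀ j, 0 < σsq j) (hσ_mono : Monotone σsq)
    (hσ_fin : ∀ j : Fin M, σsq j.castSucc < ⊤) (hσ_last : σsq (Fin.last M) = ⊤)
    (i : Fin M) (γ : ℝ) (N n : ℕ) (hn : 1 ≤ n)
    (hγ : AnnealedULA.StepCondition m L (σsq i.castSucc) γ)
    (hσ : AnnealedULA.VarianceCondition d m (σsq i.castSucc) (σsq i.succ))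
    {Ω : Type*} [MeasurableSpace Ω] (P : Measure Ω) [IsProbabilityMeasure P]
    (W : ℕ → Ω → EuclideanSpace ℝ (Fin d))
    (hW_law : ∀ k, HasLaw (W k) (stdGaussian (EuclideanSpace ℝ (Fin d))) P)
    (hW_indep : iIndepFun W P) :
    let a := AnnealedULA.tilt (σsq i.castSucc) (σsq i.succ)
    let κ := AnnealedULA.kappa m L (σsq i.castSucc)
    let X := AnnealedULA.ulaChain (AnnealedULA.potential U (σsq i.castSucc)) γ W
    let est := AnnealedULA.ulaEstimator X (AnnealedULA.tiltFun a) N n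
    MemLp est 2 P ∧
      Var[est; P] ≤
        32 * a ^ 2 * AnnealedULA.constC0 d κ a * AnnealedULA.constC1 d κ a γ / (κ ^ 2 * n * γ)
          * (1 + 2 / (κ * n * γ)) := by
  intro a κ X est
  have hs := AnnealedULA.precision_pos (hσ_fin i).ne (hσ_pos i.castSucc)
  have hmL := AnnealedULA.le_of_gradientConvex_of_gradientLipschitz hd hUL hUm
  have hT := AnnealedULA.isLangevinStep_gradient hm hmL hUL hUm hU0 hs hγ
  have ha : 0 ≤ a := AnnealedULA.tilt_nonneg (hσ_pos _) (hσ_mono (Fin.castSucc_lt_succ).le)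
  have hκγ : κ * γ ≤ 1 / 2 := AnnealedULA.kappa_mul_le hm hmL hs hγ
  -- d ≥ 1 makes 4d + 16 at least 20. The growth exponent used below is 2a, which needs 16a ≤ κ, and
  -- κγ ≤ 1/2 gives 8aγ ≤ 1/5 < 1/4.
  have haκ : 20 * a ≤ κ := by
    have h1 : a * (4 * d + 16) ≤ m + AnnealedULA.precision (σsq i.castSucc) :=
      AnnealedULA.tilt_le (hσ_pos _) hσ
    have h2 : m + AnnealedULA.precision (σsq i.castSucc) ≤ κ := AnnealedULA.kappa_ge hm hmL hs
    have h3 : (1 : ℝ) ≤ d := by exact_mod_cast hd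
    nlinarith
  have hγ0 := hT.step_pos
  have hκ0 : 0 < κ := hT.kappa_pos
  have haγ : 20 * a * γ ≤ κ * γ := mul_le_mul_of_nonneg_right haκ hγ0.le
  have hn0 : (0 : ℝ) < n := by exact_mod_cast hn
  -- The noise is only almost everywhere measurable; measurable versions change the chain on a null
  -- set and keep laws and independence.
  set W' : ℕ → Ω → EuclideanSpace ℝ (Fin d) := fun k => (hW_law k).aemeasurable.mk (W k) with hW'
  have hWW' : ∀ k, W k =ᵐ[P] W' k := fun k => (hW_law k).aemeasurable.ae_eq_mk
  set X' := AnnealedULA.ulaChain (AnnealedULA.potential U (σsq i.castSucc)) γ W' with hX'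
  have hest : est =ᵐ[P] fun ω => ∑ k ∈ Finset.range (N + n + 1),
      AnnealedULA.windowWeight N n k * AnnealedULA.tiltFun a (X' k ω) := by
    filter_upwards [ae_all_iff.2 hWW'] with ω hω
    rw [← AnnealedULA.ulaEstimator_eq_sum]
    simp only [est, AnnealedULA.ulaEstimator, X, AnnealedULA.ulaChain_congr hω, hX']
  -- The exponent 2a, rather than a, leaves room for the factor ‖x‖ in the slope.
  have hmain := hT.variance_sum_le (c := 2 * a) (W := W') (X := X') (P := P)
    (w := AnnealedULA.windowWeight N n) (K := N + n) (by linarith) (by linarith)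
    (by linarith) (AnnealedULA.hasGaussianGrowth_tiltFun ha)
    (AnnealedULA.hasGaussianGrowth_slope_tiltFun ha) (fun x => by positivity)
    (AnnealedULA.hasSlopeBound_tiltFun ha)
    (hT.integral_sq_slope_tiltFun_le ha (by linarith))
    (fun j => by unfold AnnealedULA.windowWeight; split_ifs <;> positivity)
    (fun j hj => by
      rw [AnnealedULA.windowWeight, if_neg]
      simp only [Finset.mem_Icc]; omega)
    (fun k => (hW_law k).aemeasurable.measurable_mk)
    (fun k => by rw [← Measure.map_congr (hWW' k), (hW_law k).map_eq])
    (hW_indep.congr hWW') (fun ω => rfl) (fun k ω => rfl)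
  refine ⟨hmain.1.ae_eq hest.symm, ?_⟩
  rw [variance_congr hest]
  refine hmain.2.trans ?_
  have hρ1 : √(1 - κ * γ) < 1 := by
    rw [Real.sqrt_lt' one_pos]
    nlinarith
  have hC0 : 0 ≤ AnnealedULA.constC0 d κ a := Real.exp_nonneg _
  have hC1 : 0 ≤ AnnealedULA.constC1 d κ a γ := by
    unfold AnnealedULA.constC1
    have h1 : 0 ≤ 1 - 8 * a * γ := by nlinarith
    have h2 : 0 ≤ κ - 8 * a := by linarith
    positivity
  refine le_trans ?_ (AnnealedULA.variance_constant_le hκ0 hγ0 hn0 hC0 hC1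
    hρ1 (Real.sq_sqrt (by linarith)))
  refine mul_le_mul_of_nonneg_left (mul_le_mul_of_nonneg_left ?_ (by positivity)) (by positivity)
  refine AnnealedULA.sum_sq_shifted_weights_le (b := 1 / n) ?_ ?_ ?_ ?_ (Real.sqrt_nonneg _) hρ1
  · intro j; unfold AnnealedULA.windowWeight; split_ifs <;> positivity
  · intro j
    unfold AnnealedULA.windowWeight
    split_ifs
    · exact le_rfl
    · positivity
  · intro j hj
    rw [AnnealedULA.windowWeight, if_neg]
    simp only [Finset.mem_Icc]; omega
  · intro j hj
    rw [AnnealedULA.windowWeight, if_neg]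
    simp only [Finset.mem_Icc]; omega
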